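/- Let $G$ be a (simple, undirected, possibly infinite) graph. A double ray in $G$ is a subgraph of $G$ isomorphic to the two-way infinite path, that is, to the graph with vertex set $\mathbb{Z}$ in which $i$ and $j$ are adjacent if and only if $|i-j|=1$. Suppose that for every $k\in\mathbb{N}$ there is a family of $k$ pairwise edge-disjoint double rays in $G$. Then there is an infinite family of pairwise edge-disjoint double rays in $G$. -/

import Mathlib

/-- The double ray, as an abstract graph: its vertices are the integers, and two integers are
adjacent precisely when they are consecutive. -/
def doubleRay : SimpleGraph ℤ where
  Adj i j := j = i + 1 ∨ i = j + 1
  symm := ⟨fun _ _ h => h.symm⟩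
  loopless := ⟨fun i h => by omega⟩

/-- `H.IsEdgeDisjointFamilyIn G D`: the family `D` consists of pairwise edge-disjoint subgraphs of
`G`, each of which is isomorphic to `H`. -/
def SimpleGraph.IsEdgeDisjointFamilyIn {W V ι : Type*} (H : SimpleGraph W) (G : SimpleGraph V)
    (D : ι → G.Subgraph) : Prop :=
  (∀ i, Nonempty (H ≃g (D i).coe)) ∧ ∀ i j, i ≠ j → Disjoint (D i).edgeSet (D j).edgeSet

/-- `G` has arbitrarily many edge-disjoint `H`: for every natural number `k` there is a family of
`k` edge-disjoint subgraphs of `G`, each isomorphic to `H`. -/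
def SimpleGraph.HasArbitrarilyManyEdgeDisjoint {W V : Type*} (G : SimpleGraph V)
    (H : SimpleGraph W) : Prop :=
  ∀ k : ℕ, ∃ D : Fin k → G.Subgraph, H.IsEdgeDisjointFamilyIn G D

/-- `G` has infinitely many edge-disjoint `H`: there is an infinite family of
edge-disjoint subgraphs of `G`, each isomorphic to `H`. -/
def SimpleGraph.HasInfinitelyManyEdgeDisjoint {W V : Type*} (G : SimpleGraph V)
    (H : SimpleGraph W) : Prop :=
  ∃ D : ℕ → G.Subgraph, H.IsEdgeDisjointFamilyIn G D

/-!
The union of countably many double rays can be thinned out to a locally finite graph `H` that still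
contains almost all of each of them. If the boundaries of large finite vertex sets of `H` are large,
then Hall's theorem gives an injection that moves each vertex to itself or to a neighbour and misses
infinitely many vertices; the orbits of these are disjoint rays. Either infinitely many of them lie
in different components, each of which contains a double ray, or infinitely many lie in the same
component, where they can be linked and paired off into edge-disjoint double rays.

Otherwise fix an ultrafilter of finite sets `U` with boundaries of bounded size. Along it every
double ray has one of finitely many types, recording how the part outside `U` connects the boundary
of `U`, so arbitrarily many edge-disjoint double rays share a type. Outside `U`, `k` strands of a
type can be replaced by further double rays of that type. Boundedly many members of a disjoint
family suffice to link two vertices of the boundary, so the replacement can be made to avoid one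
more double ray. Repeating this with growing `U`, and hence fixing larger and larger parts of the
strands, leaves in the limit infinitely many edge-disjoint double rays.
-/

namespace EdgeDisjointDoubleRays

open Filter Function SimpleGraph

variable {V : Type*}

theorem mem_of_reachable {K : SimpleGraph V} {S : Set V}
    (hS : ∀ ⦃a b⦄, K.Adj a b → a ∈ S → b ∈ S) {x y : V} (h : K.Reachable x y) (hx : x ∈ S) :
    y ∈ S := by
  obtain ⟨p⟩ := h
  by_contra hy
  obtain ⟨d, -, hd, hd'⟩ := p.exists_boundary_dart S hx hy
  exact hd' (hS d.adj hd)

theorem exists_adj_of_infinite_reachable {K : SimpleGraph V} {v : V}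
    (h : {w | K.Reachable v w}.Infinite) : ∃ w, K.Adj v w := by
  by_contra! hno
  refine h ((Set.finite_singleton v).subset fun w hw => ?_)
  exact mem_of_reachable (S := {v}) (fun a b hab ha => (hno b (ha ▸ hab)).elim) hw rfl

/-! ### Rays, double rays and their edges -/

/-- A path of `K` indexed by `ι`, encoded by an injective map sending consecutive indices to
adjacent vertices. The relevant index types are `ℕ`, for rays, and `ℤ`, for double rays. -/
structure IsPathMap {ι : Type*} [Add ι] [One ι] (K : SimpleGraph V) (f : ι → V) : Prop where
  injective : Injective f
  adj : ∀ n, K.Adj (f n) (f (n + 1))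

/-- A ray of `K`, as a sequence of vertices. -/
abbrev IsRay (K : SimpleGraph V) (r : ℕ → V) : Prop := IsPathMap K r

/-- A double ray of `K`, as a two-way infinite sequence of vertices. -/
abbrev IsDoubleRay (K : SimpleGraph V) (f : ℤ → V) : Prop := IsPathMap K f

/-- The graph formed by the steps `f n – f (n + 1)` of a sequence with `n ∈ s`. -/
def edgesOn {ι : Type*} [Add ι] [One ι] (f : ι → V) (s : Set ι) : SimpleGraph V :=
  fromRel fun a b => ∃ n ∈ s, f n = a ∧ f (n + 1) = b

/-- The graph formed by all steps of a sequence of vertices. -/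
abbrev trace {ι : Type*} [Add ι] [One ι] (f : ι → V) : SimpleGraph V :=
  edgesOn f Set.univ

section PathMap

variable {ι κ : Type*} [Add ι] [One ι] [Add κ] [One κ] {K L : SimpleGraph V} {f : ι → V}
  {s : Set ι} {a b : V}

theorem exists_of_edgesOn_adj (h : (edgesOn f s).Adj a b) :
    ∃ n ∈ s, f n = a ∧ f (n + 1) = b ∨ f n = b ∧ f (n + 1) = a := by
  obtain ⟨-, ⟨n, hn, h⟩ | ⟨n, hn, h⟩⟩ := (fromRel_adj _ _ _).1 h
  · exact ⟨n, hn, Or.inl h⟩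
  · exact ⟨n, hn, Or.inr h⟩

theorem edgesOn_le (h : ∀ n ∈ s, K.Adj (f n) (f (n + 1))) : edgesOn f s ≤ K := by
  intro a b hab
  obtain ⟨n, hn, ⟨rfl, rfl⟩ | ⟨rfl, rfl⟩⟩ := exists_of_edgesOn_adj hab
  · exact h n hn
  · exact (h n hn).symm

theorem mem_range_of_edgesOn_adj (h : (edgesOn f s).Adj a b) : a ∈ Set.range f := by
  obtain ⟨n, -, ⟨rfl, -⟩ | ⟨-, rfl⟩⟩ := exists_of_edgesOn_adj h <;> exact Set.mem_range_self _

theorem support_trace_subset : (trace f).support ⊆ Set.range f := by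
  rintro a ⟨b, hab⟩
  exact mem_range_of_edgesOn_adj hab

theorem disjoint_edgesOn_of_disjoint_range {g : κ → V} {u : Set κ}
    (h : Disjoint (Set.range f) (Set.range g)) : Disjoint (edgesOn f s) (edgesOn g u) :=
  disjoint_left.2 fun _ _ hf hg => Set.disjoint_left.1 h (mem_range_of_edgesOn_adj hf)
    (mem_range_of_edgesOn_adj hg)

namespace IsPathMap

theorem mono (hf : IsPathMap K f) (h : K ≤ L) : IsPathMap L f :=
  ⟨hf.injective, fun n => h (hf.adj n)⟩

theorem trace_le (hf : IsPathMap K f) : trace f ≤ K :=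
  edgesOn_le fun n _ => hf.adj n

theorem edgesOn_adj (hf : IsPathMap K f) {n : ι} (hn : n ∈ s) :
    (edgesOn f s).Adj (f n) (f (n + 1)) :=
  (fromRel_adj _ _ _).2 ⟨(hf.adj n).ne, Or.inl ⟨n, hn, rfl, rfl⟩⟩

protected theorem trace (hf : IsPathMap K f) : IsPathMap (trace f) f :=
  ⟨hf.injective, fun _ => hf.edgesOn_adj (Set.mem_univ _)⟩

end IsPathMap

end PathMap

theorem reachable_of_adj_succ {ι : Type*} [LinearOrder ι] [Add ι] [One ι]
    [SuccAddOrder ι] [IsSuccArchimedean ι] {K : SimpleGraph V} {f : ι → V} {m n : ι} (hmn : m ≤ n)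
    (h : ∀ i ∈ Set.Ico m n, K.Adj (f i) (f (i + 1))) : K.Reachable (f m) (f n) := by
  refine (reachable_iff_reflTransGen _ _).2 (Relation.ReflTransGen.lift f le_rfl _ _ ?_)
  refine reflTransGen_of_succ_of_le (K.Adj on f) (fun i hi => ?_) hmn
  rw [Order.succ_eq_add_one]
  exact h i hi

theorem IsPathMap.reachable {ι : Type*} [LinearOrder ι] [Add ι] [One ι]
    [SuccAddOrder ι] [IsSuccArchimedean ι] {K : SimpleGraph V} {f : ι → V} (hf : IsPathMap K f)
    (m n : ι) : K.Reachable (f m) (f n) := by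
  rcases le_total m n with h | h
  · exact reachable_of_adj_succ h fun i _ => hf.adj i
  · exact (reachable_of_adj_succ h fun i _ => hf.adj i).symm

section DoubleRay

variable {K : SimpleGraph V} {f : ℤ → V}

theorem IsPathMap.trace_adj_apply (hf : IsDoubleRay K f) {n : ℤ} {b : V} :
    (trace f).Adj (f n) b ↔ b = f (n - 1) ∨ b = f (n + 1) := by
  constructor
  · intro h
    obtain ⟨m, -, ⟨hm, rfl⟩ | ⟨rfl, hm⟩⟩ := exists_of_edgesOn_adj h
    · exact Or.inr (by rw [hf.injective hm])
    · exact Or.inl (by rw [← hf.injective hm, add_sub_cancel_right])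
  · rintro (rfl | rfl)
    · simpa only [sub_add_cancel] using (hf.trace.adj (n - 1)).symm
    · exact hf.trace.adj n

theorem IsPathMap.disjoint_edgesOn (hf : IsDoubleRay K f) {s t : Set ℤ} (hst : Disjoint s t) :
    Disjoint (edgesOn f s) (edgesOn f t) := by
  refine disjoint_left.2 fun a b ha hb => ?_
  obtain ⟨m, hm, hm'⟩ := exists_of_edgesOn_adj ha
  obtain ⟨n, hn, hn'⟩ := exists_of_edgesOn_adj hb
  have hmn : m = n := by
    rcases hm' with ⟨rfl, rfl⟩ | ⟨rfl, rfl⟩ <;> rcases hn' with ⟨h, h'⟩ | ⟨h, h'⟩ <;>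
      have h := hf.injective h <;> have h' := hf.injective h' <;> omega
  exact Set.disjoint_left.1 hst hm (hmn ▸ hn)

theorem IsPathMap.neg (hf : IsDoubleRay K f) : IsDoubleRay K fun n => f (-n) where
  injective := hf.injective.comp neg_injective
  adj n := by simpa only [neg_add_rev, add_comm (-1 : ℤ), neg_add_cancel_right] using
    (hf.adj (-n + -1)).symm

theorem IsPathMap.trace_neg (hf : IsDoubleRay K f) : trace (fun n => f (-n)) = trace f :=
  le_antisymm hf.trace.neg.trace_le
    (by simpa only [neg_neg] using hf.neg.trace.neg.trace_le)

theorem IsPathMap.infinite_reachable (hf : IsDoubleRay K f) (n : ℤ) :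
    {w | K.Reachable (f n) w}.Infinite :=
  (Set.infinite_range_of_injective hf.injective).mono (Set.range_subset_iff.2 (hf.reachable n))

end DoubleRay

theorem IsPathMap.tail {K : SimpleGraph V} {r : ℕ → V} (hr : IsRay K r) (c : ℕ) :
    IsRay K fun n => r (n + c) where
  injective := hr.injective.comp (add_left_injective c)
  adj n := by simpa only [add_right_comm] using hr.adj (n + c)

theorem IsPathMap.right {K : SimpleGraph V} {f : ℤ → V} (hf : IsDoubleRay K f) (c : ℤ) :
    IsRay K fun n : ℕ => f (c + n) where
  injective := hf.injective.comp ((add_right_injective c).comp Nat.cast_injective)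
  adj n := by simpa only [Nat.cast_add, Nat.cast_one, add_assoc] using hf.adj (c + n)

/-- An edge-disjoint family of double rays with property `P`. -/
def IsPacking {κ : Type*} (P : (ℤ → V) → Prop) (F : κ → ℤ → V) : Prop :=
  (∀ i, P (F i)) ∧ Pairwise (Disjoint on fun i => trace (F i))

/-- There is an infinite edge-disjoint family of double rays in `K`. -/
def HasInfinitePacking (K : SimpleGraph V) : Prop :=
  ∃ F : ℕ → ℤ → V, IsPacking (IsDoubleRay K) F

theorem HasInfinitePacking.mono {K L : SimpleGraph V} (h : HasInfinitePacking K) (hKL : K ≤ L) :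
    HasInfinitePacking L := by
  obtain ⟨F, hF, hd⟩ := h
  exact ⟨F, fun i => (hF i).mono hKL, hd⟩

theorem HasInfinitePacking.of_pairwise_disjoint {K : SimpleGraph V} {D : ℕ → SimpleGraph V}
    (hD : ∀ i, D i ≤ K) (hdisj : Pairwise (Disjoint on D)) (h : ∀ i, ∃ f, IsDoubleRay (D i) f) :
    HasInfinitePacking K := by
  choose F hF using h
  exact ⟨F, fun i => (hF i).mono (hD i), fun i j hij =>
    (hdisj hij).mono (hF i).trace_le (hF j).trace_le⟩

/-! ### Double rays as subgraphs -/

section Subgraph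

variable {G : SimpleGraph V}

/-- The embedding of the abstract double ray along a double ray of `G`. -/
def IsPathMap.toCopy {f : ℤ → V} (hf : IsDoubleRay G f) : Copy doubleRay G where
  toHom := ⟨f, by rintro a b (rfl | rfl); exacts [hf.adj _, (hf.adj _).symm]⟩
  injective' := hf.injective

theorem IsPathMap.spanningCoe_toSubgraph_toCopy {f : ℤ → V} (hf : IsDoubleRay G f) :
    hf.toCopy.toSubgraph.spanningCoe = trace f := by
  ext a b
  constructor
  · rintro ⟨m, n, rfl | rfl, rfl, rfl⟩
    · exact hf.trace.adj m
    · exact (hf.trace.adj n).symm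
  · intro hab
    obtain ⟨n, -, ⟨rfl, rfl⟩ | ⟨rfl, rfl⟩⟩ := exists_of_edgesOn_adj hab
    · exact ⟨n, n + 1, Or.inl rfl, rfl, rfl⟩
    · exact ⟨n + 1, n, Or.inr rfl, rfl, rfl⟩

theorem isDoubleRay_of_iso {D : G.Subgraph} (e : doubleRay ≃g D.coe) :
    IsDoubleRay D.spanningCoe fun n => (e n : V) where
  injective := Subtype.val_injective.comp e.injective
  adj _ := e.map_rel_iff.2 (Or.inl rfl)

theorem exists_isEdgeDisjointFamilyIn_iff {κ : Type*} :
    (∃ D : κ → G.Subgraph, doubleRay.IsEdgeDisjointFamilyIn G D) ↔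
      ∃ F : κ → ℤ → V, IsPacking (IsDoubleRay G) F := by
  constructor
  · rintro ⟨D, hD, hdisj⟩
    have hray i := isDoubleRay_of_iso (hD i).some
    refine ⟨_, fun i => (hray i).mono (D i).spanningCoe_le, fun i j hij => ?_⟩
    refine Disjoint.mono (hray i).trace_le (hray j).trace_le ?_
    exact disjoint_edgeSet.1 (hdisj i j hij)
  · rintro ⟨F, hF, hdisj⟩
    refine ⟨fun i => (hF i).toCopy.toSubgraph, fun i => ⟨(hF i).toCopy.isoToSubgraph⟩,
      fun i j hij => ?_⟩
    have := disjoint_edgeSet.2 (hdisj hij)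
    simpa only [← (hF _).spanningCoe_toSubgraph_toCopy, Subgraph.edgeSet_spanningCoe] using this

end Subgraph

/-! ### Inclusions up to finitely many vertices -/

/-- Inclusion of graphs up to edges that meet only finitely many vertices. On locally finite `D`
this says that all but finitely many edges of `D` lie in `H`. -/
def AlmostLE (D H : SimpleGraph V) : Prop := (D \ H).support.Finite

section AlmostLE

variable {D H K L : SimpleGraph V}

theorem almostLE_of_le (h : D ≤ H) : AlmostLE D H := by
  simp [AlmostLE, sdiff_eq_bot_iff.2 h]

theorem AlmostLE.trans (h : AlmostLE D H) (h' : AlmostLE H L) : AlmostLE D L := by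
  refine (Set.Finite.union h h').subset ?_
  rintro v ⟨w, hD, hL⟩
  by_cases hH : H.Adj v w
  · exact Or.inr ⟨w, hH, hL⟩
  · exact Or.inl ⟨w, hD, hH⟩

theorem AlmostLE.sup (h : AlmostLE D L) (h' : AlmostLE H L) : AlmostLE (D ⊔ H) L := by
  refine (Set.Finite.union h h').subset ?_
  rintro v ⟨w, hD | hH, hL⟩
  · exact Or.inl ⟨w, hD, hL⟩
  · exact Or.inr ⟨w, hH, hL⟩

theorem AlmostLE.finite_support_diff (h : AlmostLE D H) : (D.support \ H.support).Finite := by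
  refine Set.Finite.subset h ?_
  rintro v ⟨⟨w, hD⟩, hH⟩
  exact ⟨w, hD, fun hvw => hH ⟨w, hvw⟩⟩

theorem IsPathMap.almostLE_trace_iff {ι : Type*} [Add ι] [One ι] {f : ι → V}
    (hf : IsPathMap K f) : AlmostLE (trace f) L ↔ ∀ᶠ n in cofinite, L.Adj (f n) (f (n + 1)) := by
  constructor
  · intro h
    refine (h.preimage hf.injective.injOn).subset fun n hn => ?_
    exact ⟨f (n + 1), hf.trace.adj n, hn⟩
  · intro h
    refine ((Set.Finite.image f h).union (Set.Finite.image (fun n => f (n + 1)) h)).subset ?_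
    rintro v ⟨w, hvw, hL⟩
    obtain ⟨n, -, ⟨rfl, rfl⟩ | ⟨rfl, rfl⟩⟩ := exists_of_edgesOn_adj hvw
    · exact Or.inl ⟨n, hL, rfl⟩
    · exact Or.inr ⟨n, fun h => hL h.symm, rfl⟩

theorem IsPathMap.almostLE_trace_of_eventually_range {r q : ℕ → V} (hq : IsRay K q)
    (hr : IsRay L r) {a b : ℕ} (h : ∀ n, q (n + a) = r (n + b)) :
    AlmostLE (trace q) (trace r) := by
  rw [hq.almostLE_trace_iff, Nat.cofinite_eq_atTop]
  filter_upwards [eventually_ge_atTop a] with n hn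
  obtain ⟨m, rfl⟩ := Nat.exists_eq_add_of_le' hn
  rw [add_right_comm, h, h, add_right_comm]
  exact hr.trace.adj _

end AlmostLE

section DoubleRayTails

variable {K L : SimpleGraph V} {f : ℤ → V}

theorem IsPathMap.eventually_isRay_right (hf : IsDoubleRay K f) (h : AlmostLE (trace f) L) :
    ∀ᶠ N : ℕ in atTop, IsRay L fun n : ℕ => f (N + n) := by
  rw [hf.almostLE_trace_iff, Int.cofinite_eq, eventually_sup] at h
  obtain ⟨c, hc⟩ := eventually_atTop.1 h.2
  filter_upwards [eventually_ge_atTop c.toNat] with N hN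
  refine ⟨(hf.right N).injective, fun n => ?_⟩
  rw [Nat.cast_add, Nat.cast_one, ← add_assoc]
  exact hc _ (by omega)

theorem IsPathMap.eventually_isRay_left (hf : IsDoubleRay K f) (h : AlmostLE (trace f) L) :
    ∀ᶠ N : ℕ in atTop, IsRay L fun n : ℕ => f (-(N + n)) :=
  hf.neg.eventually_isRay_right (by rwa [hf.trace_neg])

theorem IsPathMap.almostLE_trace_tails (hf : IsDoubleRay K f) (N : ℕ) :
    AlmostLE (trace f) (trace (fun n : ℕ => f (N + n)) ⊔ trace fun n : ℕ => f (-(N + n))) := by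
  rw [hf.almostLE_trace_iff, Int.cofinite_eq, eventually_sup]
  constructor
  · filter_upwards [eventually_le_atBot (-(N : ℤ) - 1)] with n hn
    obtain ⟨m, rfl⟩ : ∃ m : ℕ, n = -(N + m) - 1 := ⟨(-n - N - 1).toNat, by omega⟩
    refine Or.inr ?_
    convert ((hf.neg.right N).trace.adj m).symm using 2 <;> push_cast <;> ring
  · filter_upwards [eventually_ge_atTop (N : ℤ)] with n hn
    obtain ⟨m, rfl⟩ : ∃ m : ℕ, n = N + m := ⟨(n - N).toNat, by omega⟩
    refine Or.inl ?_
    simpa only [Nat.cast_add, Nat.cast_one, add_assoc] using (hf.right N).trace.adj m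

end DoubleRayTails

/-! ### Joining two rays to a double ray -/

section Join

variable {K : SimpleGraph V} {q r s : ℕ → V}

/-- The two-way sequence that comes in along `s` and leaves along `q`. -/
def joinRays (s q : ℕ → V) : ℤ → V
  | .ofNat n => q n
  | .negSucc n => s n

theorem isDoubleRay_joinRays (hs : IsRay K s) (hq : IsRay K q)
    (hsq : Disjoint (Set.range s) (Set.range q)) (h : K.Adj (s 0) (q 0)) :
    IsDoubleRay K (joinRays s q) where
  injective := by
    rintro (m | m) (n | n) hmn
    · exact congrArg _ (hq.injective hmn)
    · exact (Set.disjoint_left.1 hsq ⟨n, rfl⟩ ⟨m, hmn⟩).elim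
    · exact (Set.disjoint_left.1 hsq ⟨m, rfl⟩ ⟨n, hmn.symm⟩).elim
    · exact congrArg _ (hs.injective hmn)
  adj := by
    rintro (n | _ | n)
    · exact hq.adj n
    · exact h
    · exact (hs.adj n).symm

theorem le_trace_joinRays (hf : IsDoubleRay K (joinRays s q)) :
    trace q ⊔ trace s ≤ trace (joinRays s q) :=
  sup_le (edgesOn_le fun n _ => hf.trace.adj (.ofNat n))
    (edgesOn_le fun n _ => (hf.trace.adj (.negSucc (n + 1))).symm)

theorem trace_joinRays_almostLE (hs : IsRay K s) (hq : IsRay K q)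
    (hf : IsDoubleRay K (joinRays s q)) : AlmostLE (trace (joinRays s q)) (trace q ⊔ trace s) := by
  rw [hf.almostLE_trace_iff]
  filter_upwards [(Set.finite_singleton (-1 : ℤ)).compl_mem_cofinite]
  rintro (n | _ | n) hn
  · exact Or.inl (hq.trace.adj n)
  · exact (hn rfl).elim
  · exact Or.inr (hs.trace.adj n).symm

theorem IsPathMap.exists_cons (hq : IsRay K q) {x : V} (hx : K.Adj x (q 0)) :
    ∃ p, IsRay K p ∧ p 0 = x ∧ (∀ n, p (n + 1) ∈ Set.range q) ∧
      ∃ a b, ∀ n, p (n + a) = q (n + b) := by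
  by_cases hxq : x ∈ Set.range q
  · obtain ⟨k, rfl⟩ := hxq
    exact ⟨_, hq.tail k, by rw [zero_add], fun n => ⟨_, rfl⟩, 0, k, fun n => rfl⟩
  · refine ⟨fun n => Nat.casesOn n x q, ⟨?_, ?_⟩, rfl, fun n => ⟨n, rfl⟩, 1, 0, fun n => rfl⟩
    · rintro (_ | m) (_ | n) h
      · rfl
      · exact (hxq ⟨n, h.symm⟩).elim
      · exact (hxq ⟨m, h⟩).elim
      · exact congrArg _ (hq.injective h)
    · rintro (_ | n)
      · exact hx
      · exact hq.adj n

theorem IsPathMap.exists_extension_from (hr : IsRay K r) {S : Set V}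
    (hrS : Disjoint (Set.range r) S) {x : V} (hx : x ∈ S) (h : K.Reachable x (r 0)) :
    ∃ q, IsRay K q ∧ q 0 ∈ S ∧ (∀ n, q (n + 1) ∉ S) ∧ ∃ a b, ∀ n, q (n + a) = r (n + b) := by
  let T : Set V :=
    {y | ∃ q, IsRay K q ∧ q 0 = y ∧ (∀ n, q n ∉ S) ∧ ∃ a b, ∀ n, q (n + a) = r (n + b)}
  have hxT : x ∉ T := fun ⟨_, _, hq0, hqS, _⟩ => hqS 0 (hq0 ▸ hx)
  have hrT : r 0 ∈ T := ⟨r, hr, rfl, fun n => Set.disjoint_left.1 hrS ⟨n, rfl⟩, 0, 0, fun _ => rfl⟩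
  obtain ⟨w⟩ := h
  obtain ⟨⟨⟨y, z⟩, hyz⟩, -, hy, hz⟩ := w.exists_boundary_dart Tᶜ hxT (not_not.2 hrT)
  obtain ⟨q, hq, rfl, hqS, a, b, hab⟩ := not_not.1 hz
  obtain ⟨p, hp, rfl, hpq, c, d, hcd⟩ := hq.exists_cons hyz
  have hpS : ∀ n, p (n + 1) ∉ S := fun n => by
    obtain ⟨m, hm⟩ := hpq n
    exact hm ▸ hqS m
  have hpr : ∃ a b, ∀ n, p (n + a) = r (n + b) := by
    refine ⟨a + c, b + d, fun n => ?_⟩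
    rw [← add_assoc, hcd, add_right_comm, hab]
    congr 1
    omega
  refine ⟨p, hp, by_contra fun h0 => hy ⟨p, hp, rfl, ?_, hpr⟩, hpS, hpr⟩
  rintro (_ | n)
  exacts [h0, hpS n]

theorem exists_isDoubleRay_of_rays (hr : IsRay K r) (hs : IsRay K s)
    (hrs : Disjoint (Set.range r) (Set.range s)) (h : K.Reachable (s 0) (r 0)) :
    ∃ f, IsDoubleRay K f ∧ AlmostLE (trace f) (trace r ⊔ trace s) ∧
      AlmostLE (trace r ⊔ trace s) (trace f) := by
  obtain ⟨q, hq, ⟨c, hc⟩, hqs, a, b, hab⟩ := hr.exists_extension_from hrs ⟨0, rfl⟩ h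
  have ht := hs.tail (c + 1)
  set t := fun n => s (n + (c + 1))
  have htq : Disjoint (Set.range t) (Set.range q) := by
    rw [Set.disjoint_left]
    rintro _ ⟨m, rfl⟩ ⟨n | n, hn⟩
    · have := hs.injective (hc.trans hn)
      omega
    · exact hqs n ⟨_, hn.symm⟩
  have hadj : K.Adj (t 0) (q 0) := by
    simpa only [t, zero_add, ← hc] using (hs.adj c).symm
  have hf := isDoubleRay_joinRays ht hq htq hadj
  have hts : ∀ n, t (n + 0) = s (n + (c + 1)) := fun n => rfl
  have hqr := hq.almostLE_trace_of_eventually_range hr hab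
  have hrq := hr.almostLE_trace_of_eventually_range hq fun n => (hab n).symm
  have hts' := ht.almostLE_trace_of_eventually_range hs hts
  have hst' := hs.almostLE_trace_of_eventually_range ht fun n => (hts n).symm
  refine ⟨_, hf, (trace_joinRays_almostLE ht hq hf).trans (.sup ?_ ?_), .trans (.sup ?_ ?_)
    (almostLE_of_le (le_trace_joinRays hf))⟩
  · exact hqr.trans (almostLE_of_le le_sup_left)
  · exact hts'.trans (almostLE_of_le le_sup_right)
  · exact hrq.trans (almostLE_of_le le_sup_left)
  · exact hst'.trans (almostLE_of_le le_sup_right)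

end Join

/-! ### Graphs all of whose degrees are zero or two -/

theorem IsPathMap.isCycles_trace {K : SimpleGraph V} {f : ℤ → V} (hf : IsDoubleRay K f) :
    (trace f).IsCycles := by
  rintro v ⟨w, hvw⟩
  obtain ⟨n, rfl⟩ := mem_range_of_edgesOn_adj hvw
  have hnbr : (trace f).neighborSet (f n) = {f (n - 1), f (n + 1)} :=
    Set.ext fun _ => hf.trace_adj_apply
  rw [hnbr, Set.ncard_pair (hf.injective.ne (by lia))]

section IsCycles

variable {D : SimpleGraph V} {v w a b : V}

theorem finite_neighborSet_of_isCycles (hD : D.IsCycles) (v : V) : (D.neighborSet v).Finite := by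
  rcases (D.neighborSet v).eq_empty_or_nonempty with h | h
  · exact h ▸ Set.finite_empty
  · exact Set.finite_of_ncard_pos (by rw [hD h]; exact two_pos)

theorem ncard_neighborSet_le_of_isCycles (hD : D.IsCycles) (v : V) :
    (D.neighborSet v).ncard ≤ 2 := by
  rcases (D.neighborSet v).eq_empty_or_nonempty with h | h
  · simp only [h, Set.ncard_empty, zero_le]
  · exact (hD h).le

theorem eq_of_isCycles (hD : D.IsCycles) (hw : D.Adj v w) (ha : D.Adj v a) (hb : D.Adj v b)
    (hwa : w ≠ a) (hwb : w ≠ b) : a = b :=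
  (hD.existsUnique_ne_adj hw).unique ⟨hwa, ha⟩ ⟨hwb, hb⟩

/-- A two-way infinite walk that never traverses an edge back and forth. -/
structure IsTour (D : SimpleGraph V) (f : ℤ → V) : Prop where
  adj : ∀ n, D.Adj (f n) (f (n + 1))
  ne : ∀ n, f n ≠ f (n + 2)

-- The tour is an orbit of the permutation of darts: go to the end, then leave by the other edge.
theorem exists_isTour_of_isCycles (hD : D.IsCycles) (hvw : D.Adj v w) :
    ∃ f, IsTour D f ∧ f 0 = v := by
  choose other hother hunique using fun u x (h : D.Adj u x) => hD.existsUnique_ne_adj h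
  have hinvol : ∀ u x (h : D.Adj u x), other u (other u x h) (hother u x h).2 = x := fun u x h =>
    (hunique u _ _ x ⟨(hother u x h).1.symm, h⟩).symm
  let next : Equiv.Perm {p : V × V // D.Adj p.1 p.2} :=
    { toFun p := ⟨(p.1.2, other p.1.2 p.1.1 p.2.symm), (hother _ _ _).2⟩
      invFun p := ⟨(other p.1.1 p.1.2 p.2, p.1.1), (hother _ _ _).2.symm⟩
      left_inv p := Subtype.ext (Prod.ext (hinvol _ _ _) rfl)
      right_inv p := Subtype.ext (Prod.ext rfl (hinvol _ _ _)) }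
  let dart : ℤ → {p : V × V // D.Adj p.1 p.2} := fun n => (next ^ n) ⟨(v, w), hvw⟩
  have hdart : ∀ n, dart (n + 1) = next (dart n) := fun n => by
    simp only [dart, add_comm n 1, zpow_one_add, Equiv.Perm.mul_apply]
  have hsnd : ∀ n, (dart (n + 1)).1.1 = (dart n).1.2 := fun n =>
    congrArg (·.1.1) (hdart n)
  refine ⟨fun n => (dart n).1.1, ⟨fun n => (hsnd n).symm ▸ (dart n).2, fun n => ?_⟩, rfl⟩
  have hnext : (dart (n + 2)).1.1 = (next (dart n)).1.2 := by
    rw [← hdart, ← hsnd, add_assoc, one_add_one_eq_two]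
  exact hnext ▸ (hother _ _ (dart n).2.symm).1

namespace IsTour

variable {f g : ℤ → V}

theorem shift (hf : IsTour D f) (c : ℤ) : IsTour D fun n => f (c + n) where
  adj n := by simpa only [add_assoc] using hf.adj (c + n)
  ne n := by simpa only [add_assoc] using hf.ne (c + n)

theorem neg (hf : IsTour D f) : IsTour D fun n => f (-n) where
  adj n := by simpa only [neg_add_rev, add_comm (-1 : ℤ), neg_add_cancel_right] using
    (hf.adj (-n + -1)).symm
  ne n := by simpa only [neg_add_rev, add_comm (-2 : ℤ), neg_add_cancel_right] using
    (hf.ne (-n + -2)).symm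

theorem eq_or_eq_of_adj (hf : IsTour D f) (hD : D.IsCycles) {n : ℤ} (h : D.Adj (f n) b) :
    b = f (n - 1) ∨ b = f (n + 1) := by
  have hprev : D.Adj (f n) (f (n - 1)) := by simpa only [sub_add_cancel] using (hf.adj (n - 1)).symm
  have hne : f (n - 1) ≠ f (n + 1) := by
    simpa only [show n - 1 + 2 = n + 1 by ring] using hf.ne (n - 1)
  exact or_iff_not_imp_left.2 fun hb => eq_of_isCycles hD hprev h (hf.adj n) (Ne.symm hb) hne

theorem eq_natCast (hf : IsTour D f) (hg : IsTour D g) (hD : D.IsCycles) (h0 : f 0 = g 0)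
    (h1 : f 1 = g 1) (n : ℕ) : f n = g n := by
  suffices f n = g n ∧ f (n + 1) = g (n + 1) from this.1
  induction n with
  | zero => exact ⟨by exact_mod_cast h0, by simpa only [Nat.cast_zero, zero_add] using h1⟩
  | succ n ih =>
    push_cast
    refine ⟨ih.2, ?_⟩
    have hf' := hf.adj (n + 1)
    have hg' := hg.adj (n + 1)
    have hfne := hf.ne n
    have hgne := hg.ne n
    simp only [add_assoc, one_add_one_eq_two] at hf' hg' ⊢
    rw [← ih.2] at hg'
    rw [← ih.1] at hgne
    exact eq_of_isCycles hD (ih.1 ▸ (hf.adj n).symm) hf' hg' (ih.1 ▸ hfne) (ih.1 ▸ hgne)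

theorem unique (hf : IsTour D f) (hg : IsTour D g) (hD : D.IsCycles) (h0 : f 0 = g 0)
    (h1 : f 1 = g 1) : f = g := by
  have hneg : f (-1) = g (-1) := by
    have hf1 : D.Adj (f 0) (f (-1)) := by simpa using (hf.adj (-1)).symm
    have hg1 : D.Adj (f 0) (g (-1)) := by simpa [h0] using (hg.adj (-1)).symm
    have hfne : f 1 ≠ f (-1) := by simpa using (hf.ne (-1)).symm
    have hgne : f 1 ≠ g (-1) := by simpa [h1] using (hg.ne (-1)).symm
    exact eq_of_isCycles hD (by simpa using hf.adj 0) hf1 hg1 hfne hgne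
  funext n
  obtain ⟨n, rfl | rfl⟩ := n.eq_nat_or_neg
  · exact hf.eq_natCast hg hD h0 h1 n
  · exact hf.neg.eq_natCast hg.neg hD h0 hneg n

theorem exists_apply_add_ne_apply_sub (hf : IsTour D f) (i j : ℤ) :
    ∃ n, f (i + n) ≠ f (j - n) := by
  by_contra! h
  obtain ⟨k, hk | hk⟩ := Int.even_or_odd' (j - i)
  · refine hf.ne (i + k - 1) ?_
    rw [add_sub_assoc, h (k - 1)]
    congr 1
    lia
  · refine (hf.adj (i + k)).ne ?_
    rw [h k]
    congr 1
    lia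

theorem injective (hf : IsTour D f) (hD : D.IsCycles) (hinf : (Set.range f).Infinite) :
    Injective f := by
  refine .of_lt_imp_ne fun i j hij hfij => ?_
  have hnbr : D.Adj (f j) (f (i + 1)) := hfij ▸ hf.adj i
  rcases hf.eq_or_eq_of_adj hD hnbr with hback | hforth
  · obtain ⟨n, hn⟩ := hf.exists_apply_add_ne_apply_sub i j
    refine hn ?_
    have hrefl := (hf.shift i).unique (hf.neg.shift (-j)) hD
      (by simpa only [add_zero, neg_neg] using hfij)
      (by simpa only [neg_add_rev, neg_neg, add_comm (-1 : ℤ), ← sub_eq_add_neg] using hback)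
    simpa only [neg_add_rev, neg_neg, add_comm (-n), ← sub_eq_add_neg] using congrFun hrefl n
  · have hshift := (hf.shift i).unique (hf.shift j) hD
      (by simpa only [add_zero] using hfij) hforth
    have hper : f.Periodic (j - i) := fun n => by
      have h := congrFun hshift (n - i)
      simpa only [add_sub_cancel, add_sub_left_comm j n i] using h.symm
    refine hinf ?_
    rw [← hper.image_Ioc (sub_pos.2 hij) 0]
    exact (Set.finite_Ioc _ _).image f

end IsTour

theorem exists_isDoubleRay_of_isCycles (hD : D.IsCycles) (hv : {w | D.Reachable v w}.Infinite) :
    ∃ f, IsDoubleRay D f := by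
  obtain ⟨w, hvw⟩ := exists_adj_of_infinite_reachable hv
  obtain ⟨f, hf, rfl⟩ := exists_isTour_of_isCycles hD hvw
  have hcomp : {w | D.Reachable (f 0) w} ⊆ Set.range f := fun w hw => by
    refine mem_of_reachable (fun a b hab ha => ?_) hw (Set.mem_range_self 0)
    obtain ⟨n, rfl⟩ := ha
    rcases hf.eq_or_eq_of_adj hD hab with rfl | rfl <;> exact Set.mem_range_self _
  exact ⟨f, hf.injective hD (hv.mono hcomp), hf.adj⟩

end IsCycles

/-! ### Disjoint rays from large boundaries -/

/-- The vertices outside `U` with a neighbour in `U`. -/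
def boundary (H : SimpleGraph V) (U : Finset V) : Set V :=
  {w | w ∉ U ∧ ∃ u ∈ U, H.Adj u w}

theorem injective_iterate_of_injective_sumElim {ι : Type*} {s : V → V} {a : ι → V}
    (h : Injective (Sum.elim s a)) : Injective fun p : ι × ℕ => s^[p.2] (a p.1) := by
  obtain ⟨hs, ha, hsa⟩ := Sum.elim_injective.1 h
  rintro ⟨i, m⟩ ⟨j, n⟩ hij
  dsimp only at hij
  wlog hmn : m ≤ n generalizing i j m n
  · exact (this j n i m hij.symm (le_of_not_ge hmn)).symm
  obtain ⟨n, rfl⟩ := Nat.exists_eq_add_of_le hmn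
  rw [iterate_add_apply] at hij
  cases n with
  | zero => exact Prod.ext (ha (hs.iterate m hij)) rfl
  | succ n =>
    rw [iterate_succ_apply'] at hij
    exact (hsa _ _ (hs.iterate m hij).symm).elim

section LocallyFinite

variable {H : SimpleGraph V} (hH : ∀ v, (H.neighborSet v).Finite)

include hH
theorem finite_boundary (U : Finset V) : (boundary H U).Finite := by
  refine (U.finite_toSet.biUnion fun u _ => hH u).subset ?_
  rintro w ⟨-, u, hu, huw⟩
  exact Set.mem_biUnion hu huw

open Classical in
/-- The closed neighbourhood of a finite set of vertices. -/
noncomputable def closedNeighborFinset (U : Finset V) : Finset V :=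
  U ∪ (finite_boundary hH U).toFinset

theorem mem_closedNeighborFinset {U : Finset V} {w : V} :
    w ∈ closedNeighborFinset hH U ↔ w ∈ U ∨ ∃ u ∈ U, H.Adj u w := by
  simp only [closedNeighborFinset, boundary, Finset.mem_union, Set.Finite.mem_toFinset,
    Set.mem_ofPred_eq]
  tauto

theorem card_closedNeighborFinset (U : Finset V) :
    (closedNeighborFinset hH U).card = U.card + (boundary H U).ncard := by
  classical
  rw [closedNeighborFinset, Finset.card_union_of_disjoint,
    Set.ncard_eq_toFinset_card _ (finite_boundary hH U)]
  exact Finset.disjoint_right.2 fun w hw => ((Set.Finite.mem_toFinset _).1 hw).1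

theorem closedNeighborFinset_biUnion [DecidableEq V] {ι : Type*} (S : Finset ι)
    (u : ι → Finset V) :
    closedNeighborFinset hH (S.biUnion u) = S.biUnion fun i => closedNeighborFinset hH (u i) := by
  ext w
  simp only [mem_closedNeighborFinset, Finset.mem_biUnion]
  grind

theorem exists_injective_sumElim_of_lt_ncard_boundary
    (h : ∀ d, ∃ U : Finset V, ∀ T : Finset V, U ⊆ T → d < (boundary H T).ncard) :
    ∃ (s : V → V) (a : ℕ → V), Injective (Sum.elim s a) ∧ ∀ v, s v = v ∨ H.Adj v (s v) := by
  classical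
  choose U hU using h
  let u : V ⊕ ℕ → Finset V := Sum.elim singleton U
  have hall : ∀ S : Finset (V ⊕ ℕ),
      S.card ≤ (S.biUnion fun x => closedNeighborFinset hH (u x)).card := fun S => by
    rw [← closedNeighborFinset_biUnion, card_closedNeighborFinset,
      ← S.card_toLeft_add_card_toRight]
    have hleft : S.toLeft.card ≤ (S.biUnion u).card := Finset.card_le_card fun v hv =>
      Finset.mem_biUnion.2 ⟨.inl v, Finset.mem_toLeft.1 hv, Finset.mem_singleton_self v⟩
    refine add_le_add hleft ?_
    rcases S.toRight.eq_empty_or_nonempty with hempty | hne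
    · simp only [hempty, Finset.card_empty, zero_le]
    · obtain ⟨j, hj, hmax⟩ := S.toRight.exists_max_image id hne
      have hlt := hU j (S.biUnion u) (Finset.subset_biUnion_of_mem u (Finset.mem_toRight.1 hj))
      have hright : S.toRight.card ≤ (Finset.range (j + 1)).card := Finset.card_le_card fun i hi =>
        Finset.mem_range_succ_iff.2 (hmax i hi)
      rw [Finset.card_range] at hright
      exact hright.trans hlt
  obtain ⟨e, he, het⟩ := (Finset.all_card_le_biUnion_card_iff_exists_injective _).1 hall
  refine ⟨e ∘ .inl, e ∘ .inr, by rwa [Sum.elim_comp_inl_inr], fun v => ?_⟩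
  simpa [u, mem_closedNeighborFinset] using het (.inl v)

theorem exists_disjoint_rays_of_lt_ncard_boundary
    (h : ∀ d, ∃ U : Finset V, ∀ T : Finset V, U ⊆ T → d < (boundary H T).ncard) :
    ∃ r : ℕ → ℕ → V, (∀ i, IsRay H (r i)) ∧ Pairwise (Disjoint on fun i => Set.range (r i)) := by
  obtain ⟨s, a, hsa, hs⟩ := exists_injective_sumElim_of_lt_ncard_boundary hH h
  have hinj := injective_iterate_of_injective_sumElim hsa
  have hray : ∀ i, Injective fun n => s^[n] (a i) := fun i =>
    hinj.comp (Prod.mk_right_injective i)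
  refine ⟨fun i n => s^[n] (a i), fun i => ⟨hray i, fun n => ?_⟩, fun i j hij => ?_⟩
  · have hstep := iterate_succ_apply' s n (a i)
    have hne : s (s^[n] (a i)) ≠ s^[n] (a i) := hstep ▸ (hray i).ne n.succ_ne_self
    change H.Adj (s^[n] (a i)) (s^[n + 1] (a i))
    exact hstep ▸ (hs _).resolve_left hne
  · rw [onFun, Set.disjoint_range_iff]
    exact fun m n hmn => hij (congrArg Prod.fst (hinj (a₁ := (i, m)) (a₂ := (j, n)) hmn))

end LocallyFinite

/-! ### Disjoint rays in a connected graph -/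

theorem exists_seq_of_forall_exists {α : Type*} {P : α → Prop} {R : α → α → Prop} {a : α}
    (ha : P a) (h : ∀ x, P x → ∃ y, P y ∧ R x y) :
    ∃ u : ℕ → α, u 0 = a ∧ (∀ n, P (u n)) ∧ ∀ n, R (u n) (u (n + 1)) := by
  choose next hP hR using h
  let u : ℕ → {x // P x} := fun n => Nat.rec ⟨a, ha⟩ (fun _ x => ⟨next x x.2, hP x x.2⟩) n
  exact ⟨fun n => (u n).1, rfl, fun n => (u n).2, fun n => hR _ (u n).2⟩

/-- There are infinitely many pairwise disjoint rays in the same component of `K`. -/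
def HasConnectedRays (K : SimpleGraph V) : Prop :=
  ∃ r : ℕ → ℕ → V, (∀ i, IsRay K (r i)) ∧ Pairwise (Disjoint on fun i => Set.range (r i)) ∧
    ∀ i j, K.Reachable (r i 0) (r j 0)

section Comb

variable {K : SimpleGraph V} {f : ℤ → V} {q : ℕ → ℕ → V}

theorem HasInfinitePacking.of_comb (hf : IsDoubleRay K f)
    (hq : ∀ i, IsRay (K \ trace f) (q i))
    (hqq : Pairwise (Disjoint on fun i => Set.range (q i))) {k : ℕ → ℤ} (hk : StrictMono k)
    (hkq : ∀ i, q i 0 = f (k i)) : HasInfinitePacking K := by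
  let spine : ℕ → SimpleGraph V := fun j => edgesOn f (Set.Ico (k (2 * j)) (k (2 * j + 1)))
  let D : ℕ → SimpleGraph V := fun j => spine j ⊔ (trace (q (2 * j)) ⊔ trace (q (2 * j + 1)))
  have hspine : ∀ j, spine j ≤ trace f := fun j => edgesOn_le fun n _ => hf.trace.adj n
  have hspine_tooth : ∀ j i, Disjoint (spine j) (trace (q i)) := fun j i =>
    disjoint_sdiff_self_right.mono (hspine j) (hq i).trace_le
  have htooth : ∀ ⦃i j⦄, i ≠ j → Disjoint (trace (q i)) (trace (q j)) := fun i j hij =>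
    disjoint_edgesOn_of_disjoint_range (hqq hij)
  have hdisj : Pairwise (Disjoint on D) := by
    refine (pairwise_disjoint_on D).2 fun i j hij => ?_
    have hspines : Disjoint (spine i) (spine j) := hf.disjoint_edgesOn <|
      Set.Ico_disjoint_Ico.2 <| (min_le_left _ _).trans <|
        (hk (by lia : 2 * i + 1 < 2 * j)).le.trans (le_max_right _ _)
    simp only [D, disjoint_sup_left, disjoint_sup_right]
    exact ⟨⟨hspines, (hspine_tooth _ _).symm, (hspine_tooth _ _).symm⟩,
      ⟨hspine_tooth _ _, htooth (by lia), htooth (by lia)⟩,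
      ⟨hspine_tooth _ _, htooth (by lia), htooth (by lia)⟩⟩
  refine .of_pairwise_disjoint (D := D) (fun j => ?_) hdisj fun j => ?_
  · exact sup_le ((hspine j).trans hf.trace_le) <|
      sup_le ((hq _).trace_le.trans sdiff_le) ((hq _).trace_le.trans sdiff_le)
  · have hreach : (D j).Reachable (q (2 * j) 0) (q (2 * j + 1) 0) := by
      rw [hkq, hkq]
      exact (reachable_of_adj_succ (hk (lt_add_one _)).le fun i hi => hf.edgesOn_adj hi).mono
        le_sup_left
    obtain ⟨g, hg, -⟩ := exists_isDoubleRay_of_rays (K := D j)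
      ((hq (2 * j + 1)).trace.mono (le_sup_right.trans le_sup_right))
      ((hq (2 * j)).trace.mono (le_sup_left.trans le_sup_right)) (hqq (by lia)) hreach
    exact ⟨g, hg⟩

theorem HasInfinitePacking.of_rays_from_range (hf : IsDoubleRay K f)
    (hq : ∀ i, IsRay (K \ trace f) (q i))
    (hqq : Pairwise (Disjoint on fun i => Set.range (q i))) (hqf : ∀ i, q i 0 ∈ Set.range f) :
    HasInfinitePacking K := by
  choose k hk using hqf
  have hinj : Injective k := fun i j hij => by
    by_contra hne
    exact Set.disjoint_left.1 (hqq hne) ⟨0, rfl⟩ ⟨0, by rw [← hk, ← hk, hij]⟩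
  obtain ⟨e, he | he⟩ := exists_increasing_or_nonincreasing_subseq (· < ·) k
  · exact .of_comb hf (fun i => hq (e i)) (hqq.comp_of_injective e.injective) (k := k ∘ e)
      (fun i j hij => he i j hij) fun i => (hk _).symm
  · refine .of_comb (q := q ∘ e) hf.neg (fun i => ?_) (hqq.comp_of_injective e.injective)
      (k := -(k ∘ e)) (fun i j hij => neg_lt_neg ?_) fun i => ?_
    · rw [hf.trace_neg]
      exact hq (e i)
    · exact lt_of_le_of_ne (not_lt.1 (he i j hij)) (hinj.ne (e.injective.ne hij.ne'))
    · simp only [comp_apply, Pi.neg_apply, neg_neg, hk]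

theorem exists_reachable_sdiff_trace {x y : V} (h : K.Reachable x y) (hx : x ∈ Set.range f) :
    ∃ z ∈ Set.range f, (K \ trace f).Reachable z y := by
  refine mem_of_reachable (S := {y | ∃ z ∈ Set.range f, (K \ trace f).Reachable z y})
    (fun a b hab ⟨z, hz, hza⟩ => ?_) h ⟨x, hx, .rfl⟩
  by_cases hf : (trace f).Adj a b
  · exact ⟨b, mem_range_of_edgesOn_adj hf.symm, .rfl⟩
  · exact ⟨z, hz, hza.trans (Adj.reachable ⟨hab, hf⟩)⟩

theorem HasInfinitePacking.of_unreachable_rays {t : ℕ → ℕ → V} (hf : IsDoubleRay K f)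
    (ht : ∀ i, IsRay (K \ trace f) (t i)) (htf : ∀ i, Disjoint (Set.range (t i)) (Set.range f))
    (hreach : ∀ i, K.Reachable (f 0) (t i 0))
    (hsep : Pairwise fun i j => ¬ (K \ trace f).Reachable (t i 0) (t j 0)) :
    HasInfinitePacking K := by
  have hex : ∀ i, ∃ q, IsRay (K \ trace f) q ∧ q 0 ∈ Set.range f ∧
      (K \ trace f).Reachable (t i 0) (q 0) := fun i => by
    obtain ⟨z, hz, hzt⟩ := exists_reachable_sdiff_trace (hreach i) (Set.mem_range_self 0)
    obtain ⟨q, hq, hq0, -, a, b, hab⟩ := (ht i).exists_extension_from (htf i) hz hzt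
    exact ⟨q, hq, hq0, ((ht i).reachable 0 (0 + b)).trans (hab 0 ▸ hq.reachable (0 + a) 0)⟩
  choose q hq hq0 htq using hex
  refine .of_rays_from_range hf hq (fun i j hij => ?_) hq0
  rw [onFun, Set.disjoint_range_iff]
  intro m n hmn
  refine hsep hij (((htq i).trans ((hq i).reachable 0 m)).trans ?_)
  exact hmn ▸ ((hq j).reachable n 0).trans (htq j).symm

theorem IsPathMap.exists_tail_disjoint_range {L : SimpleGraph V} {r : ℕ → V} (hr : IsRay K r)
    (hf : IsDoubleRay K f) (h : AlmostLE (trace f) L) (hrL : Disjoint (Set.range r) L.support) :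
    ∃ c, Disjoint (Set.range fun n => r (n + c)) (Set.range f) := by
  have hinter : (Set.range r ∩ Set.range f).Finite := by
    refine h.finite_support_diff.subset ?_
    rintro _ ⟨hv, m, rfl⟩
    exact ⟨⟨_, hf.trace.adj m⟩, Set.disjoint_left.1 hrL hv⟩
  have hfin : {n | r n ∈ Set.range f}.Finite :=
    (hinter.preimage hr.injective.injOn).subset fun n hn => ⟨Set.mem_range_self n, hn⟩
  obtain ⟨c, hc⟩ := hfin.bddAbove
  refine ⟨c + 1, Set.disjoint_left.2 ?_⟩
  rintro _ ⟨n, rfl⟩ hn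
  have := hc hn
  lia

theorem exists_subseq_reachable (K : SimpleGraph V) (x : ℕ → V) : ∃ e : ℕ ↪o ℕ,
    (∀ i j, K.Reachable (x (e i)) (x (e j))) ∨
      Pairwise fun i j => ¬ K.Reachable (x (e i)) (x (e j)) := by
  have : IsTrans V K.Reachable := ⟨fun _ _ _ => Reachable.trans⟩
  obtain ⟨e, he | he⟩ := exists_increasing_or_nonincreasing_subseq K.Reachable x
  · refine ⟨e, Or.inl fun i j => ?_⟩
    rcases lt_trichotomy i j with hij | rfl | hij
    exacts [he i j hij, .rfl, (he j i hij).symm]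
  · refine ⟨e, Or.inr fun i j hij hr => ?_⟩
    rcases hij.lt_or_gt with hij | hij
    exacts [he i j hij hr, he j i hij hr.symm]

theorem HasConnectedRays.hasInfinitePacking_or_exists_sdiff (h : HasConnectedRays K) :
    HasInfinitePacking K ∨ ∃ f, IsDoubleRay K f ∧ HasConnectedRays (K \ trace f) := by
  obtain ⟨r, hr, hrr, hreach⟩ := h
  obtain ⟨f, hf, hfr, hrf⟩ :=
    exists_isDoubleRay_of_rays (hr 0) (hr 1) (hrr zero_ne_one) (hreach 1 0)
  have hdisj : ∀ i, Disjoint (Set.range (r (i + 2))) (trace (r 0) ⊔ trace (r 1)).support := by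
    refine fun i => Set.disjoint_left.2 fun v hv ⟨w, hw⟩ => ?_
    rcases hw with hw | hw
    · exact Set.disjoint_left.1 (hrr (by lia : i + 2 ≠ 0)) hv (mem_range_of_edgesOn_adj hw)
    · exact Set.disjoint_left.1 (hrr (by lia : i + 2 ≠ 1)) hv (mem_range_of_edgesOn_adj hw)
  choose c hc using fun i => (hr (i + 2)).exists_tail_disjoint_range hf hfr (hdisj i)
  let t : ℕ → ℕ → V := fun i n => r (i + 2) (n + c i)
  have ht : ∀ i, IsRay (K \ trace f) (t i) := fun i =>
    ⟨((hr _).tail _).injective, fun n => ⟨((hr _).tail _).adj n, fun hn =>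
      Set.disjoint_left.1 (hc i) ⟨n, rfl⟩ (mem_range_of_edgesOn_adj hn)⟩⟩
  have htt : Pairwise (Disjoint on fun i => Set.range (t i)) := fun i j hij =>
    (hrr (by lia : i + 2 ≠ j + 2)).mono (Set.range_comp_subset_range _ (r _))
      (Set.range_comp_subset_range _ (r _))
  have hft : ∀ i, K.Reachable (f 0) (t i 0) := fun i => by
    obtain ⟨n, hn⟩ := ((hr 0).almostLE_trace_iff.1
      ((almostLE_of_le le_sup_left).trans hrf)).exists
    obtain ⟨m, hm⟩ := mem_range_of_edgesOn_adj hn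
    exact (hm ▸ hf.reachable 0 m).trans
      (((hr 0).reachable n 0).trans ((hreach _ _).trans ((hr _).reachable 0 _)))
  obtain ⟨e, he | he⟩ := exists_subseq_reachable (K \ trace f) fun i => t i 0
  · exact Or.inr ⟨f, hf, fun i => t (e i), fun i => ht _, htt.comp_of_injective e.injective, he⟩
  · exact Or.inl (.of_unreachable_rays hf (fun i => ht (e i)) (fun i => hc _) (fun i => hft _) he)

theorem HasConnectedRays.hasInfinitePacking (h : HasConnectedRays K) : HasInfinitePacking K := by
  by_contra hno
  obtain ⟨u, rfl, hu, hstep⟩ := exists_seq_of_forall_exists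
    (P := fun L => L ≤ K ∧ HasConnectedRays L)
    (R := fun L M => ∃ f, IsDoubleRay L f ∧ M = L \ trace f) ⟨le_rfl, h⟩ fun L ⟨hLK, hL⟩ => by
      obtain hinf | ⟨f, hf, hrays⟩ := hL.hasInfinitePacking_or_exists_sdiff
      · exact (hno (hinf.mono hLK)).elim
      · exact ⟨_, ⟨sdiff_le.trans hLK, hrays⟩, f, hf, rfl⟩
  choose f hf hdel using hstep
  have hanti : Antitone u := antitone_nat_of_succ_le fun n => hdel n ▸ sdiff_le
  refine hno ⟨f, fun n => (hf n).mono (hu n).1, (pairwise_disjoint_on _).2 fun i j hij => ?_⟩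
  exact disjoint_sdiff_self_right.mono_right
    (((hf j).trace_le.trans (hanti hij)).trans (hdel i).le)

theorem HasInfinitePacking.of_disjoint_rays {r : ℕ → ℕ → V} (hr : ∀ i, IsRay K (r i))
    (hrr : Pairwise (Disjoint on fun i => Set.range (r i)))
    (hf : ∀ i, ∃ f, IsDoubleRay K f ∧ r i 0 ∈ Set.range f) : HasInfinitePacking K := by
  obtain ⟨e, he | he⟩ := exists_subseq_reachable K fun i => r i 0
  · exact HasConnectedRays.hasInfinitePacking
      ⟨fun i => r (e i), fun i => hr _, hrr.comp_of_injective e.injective, he⟩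
  · choose F hF hrF using hf
    refine ⟨fun i => F (e i), fun i => hF _, fun i j hij => disjoint_left.2 fun a b hi hj => ?_⟩
    have hreach : ∀ k, (trace (F k)).Adj a b → K.Reachable (r k 0) a := fun k hk => by
      obtain ⟨m, hm⟩ := hrF k
      obtain ⟨n, rfl⟩ := mem_range_of_edgesOn_adj hk
      exact hm ▸ (hF k).reachable m n
    exact he hij ((hreach _ hi).trans (hreach _ hj).symm)

end Comb

/-! ### Exchanging the outer parts of two graphs -/

/-- The graph formed by the edges of `H` with both ends outside `U`. -/
def outside (H : SimpleGraph V) (U : Finset V) : SimpleGraph V where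
  Adj a b := H.Adj a b ∧ a ∉ U ∧ b ∉ U
  symm := ⟨fun _ _ h => ⟨h.1.symm, h.2.2, h.2.1⟩⟩
  loopless := ⟨fun _ h => h.1.ne rfl⟩

/-- The parts of `D` and `X` outside `U` have the same degrees and connect the same pairs on the
boundary of `U`, and the same boundary vertices lie in infinite components of them. -/
structure SameState (H : SimpleGraph V) (U : Finset V) (D X : SimpleGraph V) : Prop where
  degree : ∀ s ∈ boundary H U, ((D ⊓ outside H U).neighborSet s).ncard =
    ((X ⊓ outside H U).neighborSet s).ncard
  reachable : ∀ s ∈ boundary H U, ∀ t ∈ boundary H U,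
    (D ⊓ outside H U).Reachable s t ↔ (X ⊓ outside H U).Reachable s t
  infinite : ∀ s ∈ boundary H U, {w | (D ⊓ outside H U).Reachable s w}.Infinite ↔
    {w | (X ⊓ outside H U).Reachable s w}.Infinite

/-- The graph that follows `D` inside `U` and `X` outside `U`. -/
def glue (H : SimpleGraph V) (U : Finset V) (D X : SimpleGraph V) : SimpleGraph V :=
  (D \ outside H U) ⊔ (X ⊓ outside H U)

section Glue

variable {H D X Y : SimpleGraph V} {U : Finset V} {a b v w : V}

theorem SameState.symm (h : SameState H U D X) : SameState H U X D :=
  ⟨fun s hs => (h.degree s hs).symm, fun s hs t ht => (h.reachable s hs t ht).symm,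
    fun s hs => (h.infinite s hs).symm⟩

theorem SameState.trans (h : SameState H U D X) (h' : SameState H U X Y) : SameState H U D Y :=
  ⟨fun s hs => (h.degree s hs).trans (h'.degree s hs),
    fun s hs t ht => (h.reachable s hs t ht).trans (h'.reachable s hs t ht),
    fun s hs => (h.infinite s hs).trans (h'.infinite s hs)⟩

theorem mem_boundary_of_not_outside (hDU : (D \ H).support ⊆ U) (hab : D.Adj a b)
    (hout : ¬ (outside H U).Adj a b) (ha : a ∉ U) : a ∈ boundary H U ∧ b ∈ U := by
  have hH : H.Adj a b := by
    by_contra hH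
    exact ha (hDU ⟨b, hab, hH⟩)
  have hb : b ∈ U := by
    by_contra hb
    exact hout ⟨hH, ha, hb⟩
  exact ⟨⟨ha, b, hb, hH.symm⟩, hb⟩

theorem glue_adj_iff_left (h : ¬ (outside H U).Adj w b) :
    (glue H U D X).Adj w b ↔ D.Adj w b := by
  simp only [glue, sup_adj, sdiff_adj, inf_adj, h, not_false_eq_true, and_true, and_false,
    or_false]

theorem glue_adj_of_notMem_boundary (hDU : (D \ H).support ⊆ U) (hXU : (X \ H).support ⊆ U)
    (hwU : w ∉ U) (hw : w ∉ boundary H U) : (glue H U D X).Adj w b ↔ X.Adj w b := by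
  constructor
  · rintro (h | h)
    · exact (hw (mem_boundary_of_not_outside hDU h.1 h.2 hwU).1).elim
    · exact h.1
  · refine fun h => Or.inr ⟨h, ?_⟩
    by_contra hout
    exact hw (mem_boundary_of_not_outside hXU h hout hwU).1

theorem disjoint_glue {D' X' : SimpleGraph V} (hD : Disjoint D D') (hX : Disjoint X X') :
    Disjoint (glue H U D X) (glue H U D' X') := by
  rw [glue, glue, disjoint_sup_left, disjoint_sup_right, disjoint_sup_right]
  exact ⟨⟨hD.mono sdiff_le sdiff_le, disjoint_sdiff_self_left.mono_right inf_le_right⟩,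
    disjoint_sdiff_self_right.mono_left inf_le_right, hX.mono inf_le_left inf_le_left⟩

theorem ncard_neighborSet_glue (hD : (D.neighborSet w).Finite) (hX : (X.neighborSet w).Finite)
    (h : ((D ⊓ outside H U).neighborSet w).ncard = ((X ⊓ outside H U).neighborSet w).ncard) :
    ((glue H U D X).neighborSet w).ncard = (D.neighborSet w).ncard := by
  have hcard : ∀ Z : SimpleGraph V, (Z.neighborSet w).Finite →
      ((glue H U D Z).neighborSet w).ncard = ((D \ outside H U).neighborSet w).ncard +
        ((Z ⊓ outside H U).neighborSet w).ncard := fun Z hZ =>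
    Set.ncard_union_eq (Set.disjoint_left.2 fun b hb hb' => hb.2 hb'.2)
      (hD.subset fun b hb => hb.1) (hZ.subset fun b hb => hb.1)
  have hself : glue H U D D = D := (sup_comm _ _).trans (sup_inf_sdiff D _)
  rw [hcard X hX, ← h, ← hcard D hD, hself]

theorem isCycles_glue (hD : D.IsCycles) (hX : X.IsCycles) (hDU : (D \ H).support ⊆ U)
    (hXU : (X \ H).support ⊆ U) (hs : SameState H U D X) : (glue H U D X).IsCycles := by
  intro w hw
  by_cases hwU : w ∈ U
  · have hnbr : (glue H U D X).neighborSet w = D.neighborSet w :=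
      Set.ext fun _ => glue_adj_iff_left fun h => h.2.1 hwU
    rw [hnbr] at hw ⊢
    exact hD hw
  by_cases hwb : w ∈ boundary H U
  · have hcard := ncard_neighborSet_glue (finite_neighborSet_of_isCycles hD w)
      (finite_neighborSet_of_isCycles hX w) (hs.degree w hwb)
    have hpos : 0 < ((glue H U D X).neighborSet w).ncard := (Set.ncard_pos
      (((finite_neighborSet_of_isCycles hD w).union (finite_neighborSet_of_isCycles hX w)).subset
        fun b hb => hb.imp And.left And.left)).2 hw
    rw [hcard] at hpos ⊢
    exact hD (Set.nonempty_of_ncard_ne_zero hpos.ne')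
  · have hnbr : (glue H U D X).neighborSet w = X.neighborSet w :=
      Set.ext fun _ => glue_adj_of_notMem_boundary hDU hXU hwU hwb
    rw [hnbr] at hw ⊢
    exact hX hw

theorem notMem_of_reachable_outside (hv : v ∉ U) (h : (D ⊓ outside H U).Reachable v w) : w ∉ U :=
  mem_of_reachable (K := D ⊓ outside H U) (S := {w | w ∉ U}) (fun _ _ hab _ => hab.2.2.2) h hv

theorem reachable_glue_or_exists_boundary (hDU : (D \ H).support ⊆ U) (hs : SameState H U D X)
    (hv : v ∈ U) (h : D.Reachable v w) :
    (glue H U D X).Reachable v w ∨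
      ∃ s ∈ boundary H U, (glue H U D X).Reachable v s ∧ (D ⊓ outside H U).Reachable s w := by
  suffices (w ∈ U ∧ (glue H U D X).Reachable v w) ∨
      ∃ s ∈ boundary H U, (glue H U D X).Reachable v s ∧ (D ⊓ outside H U).Reachable s w from
    this.imp_left And.right
  refine mem_of_reachable (S := {w | (w ∈ U ∧ (glue H U D X).Reachable v w) ∨
    ∃ s ∈ boundary H U, (glue H U D X).Reachable v s ∧ (D ⊓ outside H U).Reachable s w})
    (fun a b hab ha => ?_) h (Or.inl ⟨hv, .rfl⟩)
  by_cases hout : (outside H U).Adj a b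
  · obtain ⟨ha, -⟩ | ⟨s, hsU, hvs, hsa⟩ := ha
    · exact (hout.2.1 ha).elim
    · exact Or.inr ⟨s, hsU, hvs, hsa.trans (Adj.reachable ⟨hab, hout⟩)⟩
  have hglue : (glue H U D X).Adj a b := Or.inl ⟨hab, hout⟩
  obtain ⟨-, hva⟩ | ⟨s, hsU, hvs, hsa⟩ := ha
  · by_cases hb : b ∈ U
    · exact Or.inl ⟨hb, hva.trans hglue.reachable⟩
    · exact Or.inr ⟨b, (mem_boundary_of_not_outside hDU hab.symm (fun h => hout h.symm) hb).1,
        hva.trans hglue.reachable, .rfl⟩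
  · obtain ⟨haU, hb⟩ :=
      mem_boundary_of_not_outside hDU hab hout (notMem_of_reachable_outside hsU.1 hsa)
    have hsa' : (glue H U D X).Reachable s a :=
      ((hs.reachable s hsU a haU).1 hsa).mono le_sup_right
    exact Or.inl ⟨hb, (hvs.trans hsa').trans hglue.reachable⟩

theorem infinite_reachable_glue (hU : (boundary H U).Finite) (hDU : (D \ H).support ⊆ U)
    (hs : SameState H U D X) (hv : v ∈ U) (hinf : {w | D.Reachable v w}.Infinite) :
    {w | (glue H U D X).Reachable v w}.Infinite := by
  by_contra hfin
  rw [Set.not_infinite] at hfin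
  have hcover : {w | D.Reachable v w} ⊆ {w | (glue H U D X).Reachable v w} ∪
      ⋃ s ∈ boundary H U ∩ {s | (glue H U D X).Reachable v s},
        {w | (D ⊓ outside H U).Reachable s w} := fun w hw =>
    (reachable_glue_or_exists_boundary hDU hs hv hw).imp id fun ⟨_, hsU, hvs, hsw⟩ =>
      Set.mem_biUnion (Set.mem_inter hsU hvs) hsw
  refine hinf ((hfin.union ((hU.inter_of_left _).biUnion fun s hsv => ?_)).subset hcover)
  by_contra hsinf
  exact (hs.infinite s hsv.1).1 hsinf
    (hfin.subset fun w hw => hsv.2.trans (hw.mono le_sup_right))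

end Glue

/-! ### Paths meeting few members of a disjoint family -/

section Avoiding

variable {ι : Type*} {G : SimpleGraph V} {Y : ι → SimpleGraph V} {J J' : Finset ι} {m n : ℕ}
  {x y z : V}

/-- The graph `G` without the edges of those `Y j` for which `j` is not in `J`. -/
def avoiding (G : SimpleGraph V) (Y : ι → SimpleGraph V) (J : Finset ι) : SimpleGraph V :=
  G \ ⨆ j ∉ J, Y j

theorem avoiding_mono (h : J ⊆ J') : avoiding G Y J ≤ avoiding G Y J' :=
  sdiff_le_sdiff_left (biSup_mono fun _ hj hj' => hj (h hj'))

theorem le_avoiding (hYG : ∀ j, Y j ≤ G) (hY : Pairwise (Disjoint on Y)) {j : ι} (hj : j ∈ J) :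
    Y j ≤ avoiding G Y J := by
  refine le_sdiff.2 ⟨hYG j, disjoint_iSup₂_iff.2 fun i hi => hY ?_⟩
  rintro rfl
  exact hi hj

theorem disjoint_avoiding {j : ι} (hj : j ∉ J) : Disjoint (Y j) (avoiding G Y J) :=
  disjoint_sdiff_self_right.mono_left (le_iSup₂_of_le j hj le_rfl)

/-- The vertices `x` and `y` are joined by a path of `G` that meets at most `n` of the graphs
`Y j`. -/
def LinkedVia (G : SimpleGraph V) (Y : ι → SimpleGraph V) (n : ℕ) (x y : V) : Prop :=
  ∃ J : Finset ι, J.card ≤ n ∧ (avoiding G Y J).Reachable x y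

namespace LinkedVia

theorem rfl : LinkedVia G Y n x x :=
  ⟨∅, zero_le, .rfl⟩

theorem symm (h : LinkedVia G Y n x y) : LinkedVia G Y n y x := by
  obtain ⟨J, hJ, h⟩ := h
  exact ⟨J, hJ, h.symm⟩

theorem mono (h : LinkedVia G Y m x y) (hmn : m ≤ n) : LinkedVia G Y n x y := by
  obtain ⟨J, hJ, h⟩ := h
  exact ⟨J, hJ.trans hmn, h⟩

theorem trans (h : LinkedVia G Y m x y) (h' : LinkedVia G Y n y z) :
    LinkedVia G Y (m + n) x z := by
  classical
  obtain ⟨I, hI, h⟩ := h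
  obtain ⟨J, hJ, h'⟩ := h'
  exact ⟨I ∪ J, (Finset.card_union_le _ _).trans (add_le_add hI hJ),
    (h.mono (avoiding_mono Finset.subset_union_left)).trans
      (h'.mono (avoiding_mono Finset.subset_union_right))⟩

end LinkedVia

theorem linkedVia_of_reachable (hYG : ∀ j, Y j ≤ G) (hY : Pairwise (Disjoint on Y)) {j : ι}
    (h : (Y j).Reachable x y) : LinkedVia G Y 1 x y :=
  ⟨{j}, (Finset.card_singleton j).le, h.mono (le_avoiding hYG hY (Finset.mem_singleton_self j))⟩

theorem LinkedVia.trans_adj (h : LinkedVia G Y n x y) (hyz : G.Adj y z)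
    (hno : ∀ j, ¬ (Y j).Adj y z) : LinkedVia G Y n x z := by
  obtain ⟨J, hJ, h⟩ := h
  refine ⟨J, hJ, h.trans (Adj.reachable ⟨hyz, ?_⟩)⟩
  simp only [iSup_adj, not_exists]
  exact fun j _ => hno j

theorem linkedVia_card_of_reachable_fromRel {S : Finset V} {s t : S}
    (h : (fromRel fun s t : S => LinkedVia G Y n s t).Reachable s t) :
    LinkedVia G Y (n * S.card) s t := by
  obtain ⟨p, hp⟩ := h.exists_isPath
  have hwalk : ∀ {s t} (p : (fromRel fun s t : S => LinkedVia G Y n s t).Walk s t),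
      LinkedVia G Y (n * p.length) s t := fun {s t} p => by
    induction p with
    | nil => exact .rfl
    | cons hadj p ih =>
      rw [Walk.length_cons, mul_add_one, add_comm]
      exact LinkedVia.trans (((fromRel_adj _ _ _).1 hadj).2.elim id .symm) ih
  refine (hwalk p).mono (Nat.mul_le_mul_left n ?_)
  simpa only [Fintype.card_coe] using hp.length_lt.le

/- A path of `G` from `x` to `y` can be followed from one vertex of `S` to the next, using at most
two of the graphs `Y j` between consecutive ones. -/
theorem linkedVia_two_mul_card {S : Finset V} (hYG : ∀ j, Y j ≤ G) (hY : Pairwise (Disjoint on Y))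
    (hYS : ∀ j a b, (Y j).Adj a b → ∃ s ∈ S, (Y j).Reachable a s) (hx : x ∈ S) (hy : y ∈ S)
    (hxy : G.Reachable x y) : LinkedVia G Y (2 * S.card) x y := by
  set Q : SimpleGraph S := fromRel fun s t => LinkedVia G Y 2 s t
  have hQ : ∀ s t : S, LinkedVia G Y 2 (s : V) t → Q.Reachable s t := fun s t h => by
    rcases eq_or_ne s t with rfl | hst
    · exact .rfl
    · exact Adj.reachable ((fromRel_adj _ _ _).2 ⟨hst, Or.inl h⟩)
  obtain ⟨s, hxs, hsy⟩ : ∃ s : S, Q.Reachable ⟨x, hx⟩ s ∧ LinkedVia G Y 1 (s : V) y := by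
    refine mem_of_reachable (S := {y | ∃ s : S, Q.Reachable ⟨x, hx⟩ s ∧ LinkedVia G Y 1 (s : V) y})
      (fun a b hab ⟨s, hxs, hsa⟩ => ?_) hxy ⟨⟨x, hx⟩, .rfl, .rfl⟩
    by_cases hj : ∃ j, (Y j).Adj a b
    · obtain ⟨j, hj⟩ := hj
      obtain ⟨t, ht, hat⟩ := hYS j a b hj
      refine ⟨⟨t, ht⟩, hxs.trans (hQ _ _ (hsa.trans (linkedVia_of_reachable hYG hY hat))), ?_⟩
      exact linkedVia_of_reachable hYG hY (hat.symm.trans hj.reachable)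
    · exact ⟨s, hxs, hsa.trans_adj hab (not_exists.1 hj)⟩
  exact linkedVia_card_of_reachable_fromRel
    (hxs.trans (hQ s ⟨y, hy⟩ (hsy.mono one_le_two)))

end Avoiding

/-! ### Double rays of the same type -/

/-- `D` is, up to finitely many edges, contained in `H`, and along `𝓕` it eventually looks like
the reference graph `R` from inside the finite sets. -/
structure HasType (H : SimpleGraph V) (𝓕 : Filter (Finset V)) (R D : SimpleGraph V) : Prop where
  almostLE : AlmostLE D H
  sameState : ∀ᶠ U in 𝓕, SameState H U D R

/-- The sequence `f` is a double ray of `G` whose trace has the type of `R`. -/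
def IsTypedDoubleRay (G H : SimpleGraph V) (𝓕 : Filter (Finset V)) (R : SimpleGraph V)
    (f : ℤ → V) : Prop :=
  IsDoubleRay G f ∧ HasType H 𝓕 R (trace f)

/-- There are arbitrarily large finite edge-disjoint families of two-way infinite sequences
satisfying `P`. -/
def HasPackings (P : (ℤ → V) → Prop) : Prop :=
  ∀ k : ℕ, ∃ F : Fin k → ℤ → V, IsPacking P F

section HasType

variable {D G H K R X : SimpleGraph V} {𝓕 : Filter (Finset V)} {U : Finset V}

theorem eventually_subset_of_finite {s : Set V} (hs : s.Finite) :
    ∀ᶠ U : Finset V in atTop, s ⊆ U := by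
  filter_upwards [eventually_ge_atTop hs.toFinset] with U hU
  exact hs.toFinset_subset.1 hU

theorem almostLE_outside (h : AlmostLE D H) (hD : ∀ v, (D.neighborSet v).Finite) (U : Finset V) :
    AlmostLE D (outside H U) := by
  refine ((Set.Finite.union h U.finite_toSet).union
    (U.finite_toSet.biUnion fun u _ => hD u)).subset ?_
  rintro a ⟨b, hab, hout⟩
  by_cases hH : H.Adj a b
  · by_cases ha : a ∈ U
    · exact Or.inl (Or.inr ha)
    · have hb : b ∈ U := by_contra fun hb => hout ⟨hH, ha, hb⟩
      exact Or.inr (Set.mem_biUnion hb hab.symm)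
  · exact Or.inl (Or.inl ⟨b, hab, hH⟩)

theorem eventually_sameState (h : AlmostLE D X) (h' : AlmostLE X D) :
    ∀ᶠ U in atTop, SameState H U D X := by
  filter_upwards [eventually_subset_of_finite h, eventually_subset_of_finite h'] with U hU hU'
  have hle : ∀ {Y Z : SimpleGraph V}, (Y \ Z).support ⊆ U → Y ⊓ outside H U ≤ Z ⊓ outside H U :=
    fun hYZ a b hab => ⟨by_contra fun hZ => hab.2.2.1 (hYZ ⟨b, hab.1, hZ⟩), hab.2⟩
  have heq : D ⊓ outside H U = X ⊓ outside H U := le_antisymm (hle hU) (hle hU')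
  exact ⟨fun _ _ => by rw [heq], fun _ _ _ _ => by rw [heq], fun _ _ => by rw [heq]⟩

theorem HasType.of_almostLE (hX : HasType H 𝓕 R X) (h𝓕 : 𝓕 ≤ atTop) (h : AlmostLE D X)
    (h' : AlmostLE X D) : HasType H 𝓕 R D where
  almostLE := h.trans hX.almostLE
  sameState := by
    filter_upwards [h𝓕 (eventually_sameState h h'), hX.sameState] with U hDX hXR
    exact hDX.trans hXR

theorem HasType.glue (hX : HasType H 𝓕 R X) (h𝓕 : 𝓕 ≤ atTop) (hDH : AlmostLE D H)
    (hDfin : ∀ v, (D.neighborSet v).Finite) (hXfin : ∀ v, (X.neighborSet v).Finite) :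
    HasType H 𝓕 R (glue H U D X) := by
  refine hX.of_almostLE h𝓕 (AlmostLE.sup ?_ (almostLE_of_le inf_le_left)) ?_
  · refine Set.Finite.subset (almostLE_outside hDH hDfin U) ?_
    exact support_mono sdiff_le
  · refine Set.Finite.subset (almostLE_outside hX.almostLE hXfin U) (support_mono ?_)
    exact fun a b hab => ⟨hab.1, fun hout => hab.2 (Or.inr ⟨hab.1, hout⟩)⟩

theorem HasPackings.exists_disjoint {P : (ℤ → V) → Prop} (hP : HasPackings P)
    {A : SimpleGraph V} (hA : A.support.Finite) : ∃ f, P f ∧ Disjoint (trace f) A := by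
  have hAe : A.edgeSet.Finite := by
    refine (hA.image2 (fun a b => s(a, b)) hA).subset fun e => ?_
    induction e with
    | h a b => exact fun hab => ⟨a, ⟨b, hab⟩, b, ⟨a, hab.symm⟩, rfl⟩
  have := hAe.fintype
  obtain ⟨F, hF, hFF⟩ := hP (Fintype.card A.edgeSet + 1)
  by_contra! hno
  have hmeet : ∀ i, ∃ e : A.edgeSet, (e : Sym2 V) ∈ (trace (F i)).edgeSet := fun i => by
    obtain ⟨e, he, heA⟩ := Set.not_disjoint_iff.1
      (disjoint_edgeSet.not.2 (hno (F i) (hF i)))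
    exact ⟨⟨e, heA⟩, he⟩
  choose e he using hmeet
  obtain ⟨i, j, hij, heq⟩ := Fintype.exists_ne_map_eq_of_card_lt e (by simp)
  exact Set.disjoint_left.1 (disjoint_edgeSet.2 (hFF hij)) (he i) (heq ▸ he j)

theorem exists_reachable_boundary {x y : V} (hDU : (D \ H).support ⊆ U) (h : D.Reachable x y)
    (hx : x ∉ U) (hy : y ∈ U) : ∃ s ∈ boundary H U, (D ⊓ outside H U).Reachable x s := by
  refine mem_of_reachable (K := D)
    (S := {x | x ∉ U → ∃ s ∈ boundary H U, (D ⊓ outside H U).Reachable x s})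
    (fun a b hab ha hb => ?_) h.symm (fun hyU => (hyU hy).elim) hx
  by_cases hout : (outside H U).Adj b a
  · obtain ⟨s, hs, has⟩ := ha hout.2.2
    have hba : (D ⊓ outside H U).Adj b a := ⟨hab.symm, hout⟩
    exact ⟨s, hs, hba.reachable.trans has⟩
  · exact ⟨b, (mem_boundary_of_not_outside hDU hab.symm hout hb).1, .rfl⟩

theorem IsPathMap.exists_mem_boundary_infinite {r : ℕ → V} (hr : IsRay (K ⊓ H) r)
    (h0 : r 0 ∈ U) :
    ∃ m, r m ∈ boundary H U ∧ {w | (K ⊓ outside H U).Reachable (r m) w}.Infinite := by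
  have hfin : {n | r n ∈ U}.Finite := U.finite_toSet.preimage hr.injective.injOn
  obtain ⟨n, hn, hmax⟩ := hfin.exists_maximal ⟨0, h0⟩
  have hout : ∀ k, r (k + (n + 1)) ∉ U := fun k hk => by
    have := hmax hk (by omega)
    omega
  have htail : IsRay (K ⊓ outside H U) fun k => r (k + (n + 1)) := by
    refine ⟨(hr.tail _).injective, fun k => ⟨((hr.tail (n + 1)).adj k).1,
      ((hr.tail (n + 1)).adj k).2, hout k, hout (k + 1)⟩⟩
  refine ⟨0 + (n + 1), ⟨hout 0, r n, hn, ?_⟩, ?_⟩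
  · simpa only [zero_add] using (hr.adj n).2
  · exact (Set.infinite_range_of_injective htail.injective).mono
      (Set.range_subset_iff.2 (htail.reachable 0))

/- A typed double ray `g` that avoids `A` and meets the same boundary vertices in infinite parts as
`f` does passes through both tails of `f`. -/
theorem exists_reachable_tails [NeBot 𝓕] (h𝓕 : 𝓕 ≤ atTop)
    (hP : HasPackings (IsTypedDoubleRay G H 𝓕 R)) {A : SimpleGraph V} (hA : A.support.Finite)
    {f : ℤ → V} (hf : IsTypedDoubleRay G H 𝓕 R f) :
    ∀ᶠ N : ℕ in atTop, ∃ m n : ℕ, (G \ A).Reachable (f (N + m)) (f (-(N + n))) := by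
  obtain ⟨hf, hfR⟩ := hf
  obtain ⟨g, ⟨hg, hgR⟩, hgA⟩ := hP.exists_disjoint hA
  have hfH : AlmostLE (trace f) (trace f ⊓ H) := by
    rw [AlmostLE, sdiff_inf_self_left]
    exact hfR.almostLE
  filter_upwards [hf.eventually_isRay_right hfH, hf.eventually_isRay_left hfH] with N hr hs
  have hbase : ∀ᶠ U : Finset V in 𝓕, {f (N + (0 : ℕ)), f (-(N + (0 : ℕ)))} ⊆ (↑U : Set V) :=
    h𝓕 (eventually_subset_of_finite (Set.toFinite _))
  obtain ⟨U, hU, hfU, hgU⟩ := (hbase.and (hfR.sameState.and hgR.sameState)).exists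
  have hmem : ∀ x ∈ boundary H U, {w | (trace f ⊓ outside H U).Reachable x w}.Infinite →
      x ∈ Set.range g := by
    intro x hx hinf
    obtain ⟨w, hw⟩ :=
      exists_adj_of_infinite_reachable (((hfU.trans hgU.symm).infinite x hx).1 hinf)
    exact mem_range_of_edgesOn_adj hw.1
  obtain ⟨m, hm, hminf⟩ := hr.exists_mem_boundary_infinite (hU (by simp))
  obtain ⟨n, hn, hninf⟩ := hs.exists_mem_boundary_infinite (hU (by simp))
  obtain ⟨a, ha⟩ := hmem _ hm hminf
  obtain ⟨b, hb⟩ := hmem _ hn hninf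
  refine ⟨m, n, ?_⟩
  rw [← ha, ← hb]
  exact (hg.trace.reachable a b).mono (le_sdiff.2 ⟨hg.trace_le, hgA⟩)

end HasType

/-! ### Exchanging strands -/

/-- A graph with all degrees zero or two, contained in `G`, of the type of `R` and with infinite
component of `v`. Unlike double rays, such graphs survive an exchange of their outer parts. -/
structure IsStrand (G H : SimpleGraph V) (𝓕 : Filter (Finset V)) (R D : SimpleGraph V)
    (v : V) : Prop where
  le : D ≤ G
  isCycles : D.IsCycles
  infinite : {w | D.Reachable v w}.Infinite
  hasType : HasType H 𝓕 R D

section Exchange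

variable {D G H R : SimpleGraph V} {𝓕 : Filter (Finset V)} {U : Finset V} {v : V}

theorem IsTypedDoubleRay.isStrand {f : ℤ → V} (hf : IsTypedDoubleRay G H 𝓕 R f) :
    IsStrand G H 𝓕 R (trace f) (f 0) :=
  ⟨hf.1.trace_le, hf.1.isCycles_trace, hf.1.trace.infinite_reachable 0, hf.2⟩

theorem IsStrand.eventually (hD : IsStrand G H 𝓕 R D v) (h𝓕 : 𝓕 ≤ atTop) :
    ∀ᶠ U : Finset V in 𝓕, v ∈ U ∧ (D \ H).support ⊆ U ∧ SameState H U D R := by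
  filter_upwards [h𝓕 (eventually_ge_atTop {v}),
    h𝓕 (eventually_subset_of_finite hD.hasType.almostLE), hD.hasType.sameState] with U hv hU hs
  exact ⟨Finset.singleton_subset_iff.1 hv, hU, hs⟩

theorem IsStrand.glue {X : SimpleGraph V} {x : V} (hH : ∀ v, (H.neighborSet v).Finite)
    (h𝓕 : 𝓕 ≤ atTop) (hD : IsStrand G H 𝓕 R D v) (hX : IsStrand G H 𝓕 R X x) (hv : v ∈ U)
    (hDU : (D \ H).support ⊆ U) (hXU : (X \ H).support ⊆ U) (hs : SameState H U D X) :
    IsStrand G H 𝓕 R (glue H U D X) v where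
  le := sup_le (sdiff_le.trans hD.le) (inf_le_left.trans hX.le)
  isCycles := isCycles_glue hD.isCycles hX.isCycles hDU hXU hs
  infinite := infinite_reachable_glue (finite_boundary hH U) hDU hs hv hD.infinite
  hasType := hX.hasType.glue h𝓕 hD.hasType.almostLE (finite_neighborSet_of_isCycles hD.isCycles)
    (finite_neighborSet_of_isCycles hX.isCycles)

section NewDoubleRay

variable {κ : Type*} {F : κ → ℤ → V} {A : SimpleGraph V}

theorem inf_outside_le_sdiff {X : SimpleGraph V} (hX : X ≤ G) (hAU : Disjoint A (outside H U)) :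
    X ⊓ outside H U ≤ G \ A :=
  le_sdiff.2 ⟨inf_le_left.trans hX, hAU.symm.mono_left inf_le_right⟩

theorem linkedVia_of_mem_boundary (hU : (boundary H U).Finite) (hF : IsPacking (IsDoubleRay G) F)
    (h0 : ∀ j, F j 0 ∈ U) (hFU : ∀ j, (trace (F j) \ H).support ⊆ U)
    (hAU : Disjoint A (outside H U)) {x y : V} (hx : x ∈ boundary H U) (hy : y ∈ boundary H U)
    (hxy : (G \ A).Reachable x y) :
    LinkedVia (G \ A) (fun j => trace (F j) ⊓ outside H U) (2 * (boundary H U).ncard) x y := by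
  rw [Set.ncard_eq_toFinset_card _ hU]
  refine linkedVia_two_mul_card (fun j => inf_outside_le_sdiff (hF.1 j).trace_le hAU)
    (fun i j hij => (hF.2 hij).mono inf_le_left inf_le_left) (fun j a b hab => ?_)
    (hU.mem_toFinset.2 hx) (hU.mem_toFinset.2 hy) hxy
  obtain ⟨n, rfl⟩ := mem_range_of_edgesOn_adj hab.1
  obtain ⟨s, hs, has⟩ :=
    exists_reachable_boundary (hFU j) ((hF.1 j).trace.reachable n 0) hab.2.2.1 (h0 j)
  exact ⟨s, hU.mem_toFinset.2 hs, has⟩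

theorem exists_isTypedDoubleRay_avoiding [NeBot 𝓕] (h𝓕 : 𝓕 ≤ atTop)
    (hH : ∀ v, (H.neighborSet v).Finite) (hP : HasPackings (IsTypedDoubleRay G H 𝓕 R))
    (hF : IsPacking (IsTypedDoubleRay G H 𝓕 R) F) (j : κ) (h0 : ∀ j, F j 0 ∈ U)
    (hFU : ∀ j, (trace (F j) \ H).support ⊆ U) (hA : A.support.Finite)
    (hAU : Disjoint A (outside H U)) :
    ∃ g, ∃ J : Finset κ, J.card ≤ 2 * (boundary H U).ncard + 1 ∧
      IsTypedDoubleRay (avoiding (G \ A) (fun j => trace (F j) ⊓ outside H U) J) H 𝓕 R g := by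
  classical
  set Y : κ → SimpleGraph V := fun j => trace (F j) ⊓ outside H U
  obtain ⟨hf, hfR⟩ := hF.1 j
  have hFG : IsPacking (IsDoubleRay G) F := ⟨fun i => (hF.1 i).1, hF.2⟩
  have hYG : ∀ i, Y i ≤ G \ A := fun i => inf_outside_le_sdiff (hFG.1 i).trace_le hAU
  have hfY : AlmostLE (trace (F j)) (Y j) := by
    rw [AlmostLE, sdiff_inf_self_left]
    exact almostLE_outside hfR.almostLE (finite_neighborSet_of_isCycles hf.isCycles_trace) U
  obtain ⟨N, hr, hs, hN, m, n, hmn⟩ := ((hf.eventually_isRay_right hfY).and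
    ((hf.eventually_isRay_left hfY).and ((eventually_ge_atTop 1).and
      (exists_reachable_tails h𝓕 hP hA (hF.1 j))))).exists
  have htoBoundary : ∀ k : ℤ, F j k ∉ U → ∃ x ∈ boundary H U, (Y j).Reachable (F j k) x :=
    fun k hk => exists_reachable_boundary (hFU j) (hf.trace.reachable k 0) hk (h0 j)
  obtain ⟨x, hx, hrx⟩ := htoBoundary _ (hr.adj 0).2.2.1
  obtain ⟨y, hy, hsy⟩ := htoBoundary _ (hs.adj 0).2.2.1
  have hyx : (G \ A).Reachable y x :=
    (((hsy.symm.trans (hs.reachable 0 n)).mono (hYG j)).trans hmn.symm).trans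
      (((hr.reachable m 0).trans hrx).mono (hYG j))
  obtain ⟨J, hJ, hJyx⟩ := linkedVia_of_mem_boundary (finite_boundary hH U) hFG h0 hFU hAU hy hx hyx
  have hYΓ : Y j ≤ avoiding (G \ A) Y (insert j J) :=
    le_avoiding hYG (fun i k hik => (hF.2 hik).mono inf_le_left inf_le_left)
      (Finset.mem_insert_self j J)
  have hrs : Disjoint (Set.range fun n : ℕ => F j (N + n))
      (Set.range fun n : ℕ => F j (-(N + n))) := by
    refine Set.disjoint_range_iff.2 fun a b hab => ?_
    have := hf.injective hab
    omega
  obtain ⟨g, hg, hgrs, hrsg⟩ := exists_isDoubleRay_of_rays (hr.mono hYΓ) (hs.mono hYΓ) hrs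
    ((hsy.mono hYΓ).trans ((hJyx.mono (avoiding_mono (Finset.subset_insert j J))).trans
      (hrx.symm.mono hYΓ)))
  refine ⟨g, insert j J, (Finset.card_insert_le j J).trans (Nat.add_le_add_right hJ 1), hg, ?_⟩
  refine hfR.of_almostLE h𝓕 (hgrs.trans (almostLE_of_le ?_))
    ((hf.almostLE_trace_tails N).trans hrsg)
  exact (sup_le hr.trace_le hs.trace_le).trans inf_le_left

end NewDoubleRay

theorem exists_exchange [NeBot 𝓕] (h𝓕 : 𝓕 ≤ atTop) (hH : ∀ v, (H.neighborSet v).Finite) {d : ℕ}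
    (hd : ∀ᶠ U in 𝓕, (boundary H U).ncard ≤ d) (hP : HasPackings (IsTypedDoubleRay G H 𝓕 R))
    {ι : Type*} [Finite ι] {D : ι → SimpleGraph V} {v : ι → V}
    (hD : ∀ i, IsStrand G H 𝓕 R (D i) (v i)) (hDD : Pairwise (Disjoint on D)) (W : Finset V) :
    ∃ (D' : ι → SimpleGraph V) (g : ℤ → V), (∀ i, IsStrand G H 𝓕 R (D' i) (v i)) ∧
      IsTypedDoubleRay G H 𝓕 R g ∧ Pairwise (Disjoint on D') ∧ (∀ i, Disjoint (D' i) (trace g)) ∧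
      ∀ i w, w ∈ W ∨ w ∉ H.support → (D' i).neighborSet w = (D i).neighborSet w := by
  have := Fintype.ofFinite ι
  obtain ⟨F, hF⟩ := hP (Fintype.card ι + 2 * d + 1)
  have hFs := fun j => (hF.1 j).isStrand
  obtain ⟨U, hWU, hdU, hDU, hFU⟩ := (((eventually_ge_atTop W).filter_mono h𝓕).and (hd.and
    ((eventually_all.2 fun i => (hD i).eventually h𝓕).and
      (eventually_all.2 fun j => (hFs j).eventually h𝓕)))).exists
  let A : SimpleGraph V := ⨆ i, D i \ outside H U
  have hA : A.support.Finite := by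
    refine (Set.finite_iUnion fun i => almostLE_outside (hD i).hasType.almostLE
      (finite_neighborSet_of_isCycles (hD i).isCycles) U).subset ?_
    rintro a ⟨b, hab⟩
    obtain ⟨i, hi⟩ := iSup_adj.1 hab
    exact Set.mem_iUnion.2 ⟨i, b, hi⟩
  obtain ⟨g, J, hJ, hg, hgR⟩ := exists_isTypedDoubleRay_avoiding h𝓕 hH hP hF 0
    (fun j => (hFU j).1) (fun j => (hFU j).2.1) hA
    (iSup_disjoint_iff.2 fun i => disjoint_sdiff_self_left)
  obtain ⟨e⟩ : Nonempty (ι ↪ (Jᶜ : Finset (Fin (Fintype.card ι + 2 * d + 1)))) := by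
    refine Embedding.nonempty_of_card_le ?_
    rw [Fintype.card_coe, Finset.card_compl, Fintype.card_fin]
    omega
  refine ⟨fun i => glue H U (D i) (trace (F (e i))), g, fun i => ?_,
    ⟨hg.mono (sdiff_le.trans sdiff_le), hgR⟩, fun i k hik => ?_, fun i => ?_, fun i w hw => ?_⟩
  · exact (hD i).glue hH h𝓕 (hFs _) (hDU i).1 (hDU i).2.1 (hFU _).2.1
      ((hDU i).2.2.trans (hFU _).2.2.symm)
  · exact disjoint_glue (hDD hik) (hF.2 (Subtype.coe_injective.ne (e.injective.ne hik)))
  · refine disjoint_sup_left.2 ⟨?_, ?_⟩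
    · have hAG : Disjoint A (G \ A) := disjoint_sdiff_self_right
      exact hAG.mono (le_iSup (fun i => D i \ outside H U) i) (hg.trace_le.trans sdiff_le)
    · exact (disjoint_avoiding (Y := fun j => trace (F j) ⊓ outside H U)
        (Finset.mem_compl.1 (e i).2)).mono_right hg.trace_le
  · refine Set.ext fun b => glue_adj_iff_left fun hwb => ?_
    exact hw.elim (fun hw => hwb.2.1 (hWU hw)) fun hw => hw ⟨b, hwb.1⟩

end Exchange

/-! ### Limits of exchanges -/

/-- The graphs `D k` converge to `E`: the neighbors of every vertex eventually agree. -/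
def LocallyConverges (D : ℕ → SimpleGraph V) (E : SimpleGraph V) : Prop :=
  ∀ w, ∀ᶠ k in atTop, (D k).neighborSet w = E.neighborSet w

section LocallyConverges

variable {D D' : ℕ → SimpleGraph V} {E E' G : SimpleGraph V} {v : V}

theorem exists_locallyConverges
    (h : ∀ w, ∀ᶠ k in atTop, (D (k + 1)).neighborSet w = (D k).neighborSet w) :
    ∃ E, LocallyConverges D E := by
  have hconst : ∀ w, ∃ s : Set V, ∀ᶠ k in atTop, (D k).neighborSet w = s := fun w => by
    obtain ⟨n, hn⟩ := eventually_atTop.1 (h w)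
    refine ⟨(D n).neighborSet w, eventually_atTop.2 ⟨n, fun k hk => ?_⟩⟩
    induction k, hk using Nat.le_induction with
    | base => rfl
    | succ k hk ih => exact (hn k hk).trans ih
  choose s hs using hconst
  have hmem : ∀ a b, ∀ᶠ k in atTop, ((D k).Adj a b ↔ b ∈ s a) := fun a b =>
    (hs a).mono fun k hk => hk ▸ Iff.rfl
  refine ⟨⟨fun a b => b ∈ s a, ⟨fun a b hab => ?_⟩, ⟨fun a ha => ?_⟩⟩, hs⟩
  · obtain ⟨k, hk, hk'⟩ := ((hmem a b).and (hmem b a)).exists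
    exact hk'.1 (hk.2 hab).symm
  · obtain ⟨k, hk⟩ := (hmem a a).exists
    exact (hk.2 ha).ne rfl

namespace LocallyConverges

theorem eventually_adj (h : LocallyConverges D E) {a b : V} (hab : E.Adj a b) :
    ∀ᶠ k in atTop, (D k).Adj a b :=
  (h a).mono fun _ hk => hk.ge hab

theorem isCycles (h : LocallyConverges D E) (hD : ∀ᶠ k in atTop, (D k).IsCycles) :
    E.IsCycles := by
  intro w hw
  obtain ⟨k, hk, hDk⟩ := ((h w).and hD).exists
  rw [← hk] at hw ⊢
  exact hDk hw

theorem le (h : LocallyConverges D E) (hD : ∀ᶠ k in atTop, D k ≤ G) : E ≤ G := by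
  intro a b hab
  obtain ⟨k, hk, hDk⟩ := ((h.eventually_adj hab).and hD).exists
  exact hDk hk

theorem disjoint (h : LocallyConverges D E) (h' : LocallyConverges D' E')
    (hD : ∀ᶠ k in atTop, Disjoint (D k) (D' k)) : Disjoint E E' := by
  refine disjoint_left.2 fun a b hab hab' => ?_
  obtain ⟨k, hk, hk', hDk⟩ := ((h.eventually_adj hab).and ((h'.eventually_adj hab').and hD)).exists
  exact disjoint_left.1 hDk _ _ hk hk'

theorem infinite_reachable (h : LocallyConverges D E)
    (hD : ∀ᶠ k in atTop, {w | (D k).Reachable v w}.Infinite) :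
    {w | E.Reachable v w}.Infinite := by
  intro hfin
  have hnbr : ∀ᶠ k in atTop, ∀ w ∈ {w | E.Reachable v w}, (D k).neighborSet w = E.neighborSet w :=
    (eventually_all_finite hfin).2 fun w _ => h w
  obtain ⟨k, hk, hDk⟩ := (hnbr.and hD).exists
  refine hDk (hfin.subset fun w hw => ?_)
  refine mem_of_reachable (S := {w | E.Reachable v w}) (fun a b hab ha => ?_) hw .rfl
  exact ha.trans (Adj.reachable ((hk a ha).le hab))

end LocallyConverges

end LocallyConverges

/-- The first `k` graphs of the sequence `S` are edge-disjoint strands, each at the vertex paired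
with it. -/
structure IsStage (G H : SimpleGraph V) (𝓕 : Filter (Finset V)) (R : SimpleGraph V) (k : ℕ)
    (S : ℕ → SimpleGraph V × V) : Prop where
  isStrand : ∀ l < k, IsStrand G H 𝓕 R (S l).1 (S l).2
  disjoint : (Set.Iio k).PairwiseDisjoint fun l => (S l).1

section Stages

variable {G H R : SimpleGraph V} {𝓕 : Filter (Finset V)} [NeBot 𝓕] {d : ℕ}

theorem IsStage.exists_succ {k : ℕ} {S : ℕ → SimpleGraph V × V} (hS : IsStage G H 𝓕 R k S)
    (h𝓕 : 𝓕 ≤ atTop) (hH : ∀ v, (H.neighborSet v).Finite)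
    (hd : ∀ᶠ U in 𝓕, (boundary H U).ncard ≤ d) (hP : HasPackings (IsTypedDoubleRay G H 𝓕 R))
    (W : Finset V) :
    ∃ S', IsStage G H 𝓕 R (k + 1) S' ∧ ∀ l < k, (S' l).2 = (S l).2 ∧
      ∀ w, w ∈ W ∨ w ∉ H.support → (S' l).1.neighborSet w = (S l).1.neighborSet w := by
  obtain ⟨D, g, hD, hg, hDD, hDg, hW⟩ := exists_exchange h𝓕 hH hd hP
    (ι := Set.Iio k) (fun l => hS.isStrand l l.2)
    (fun l m hlm => hS.disjoint l.2 m.2 (Subtype.coe_injective.ne hlm)) W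
  let S' : ℕ → SimpleGraph V × V :=
    fun l => if h : l < k then (D ⟨l, h⟩, (S l).2) else (trace g, g 0)
  have hlt : ∀ l (h : l < k), S' l = (D ⟨l, h⟩, (S l).2) := fun l h => dif_pos h
  have hk : S' k = (trace g, g 0) := dif_neg (lt_irrefl k)
  refine ⟨S', ⟨fun l hl => ?_, ?_⟩, fun l hl => ?_⟩
  · rcases Nat.lt_succ_iff_lt_or_eq.1 hl with hl | rfl
    · rw [hlt l hl]
      exact hD ⟨l, hl⟩
    · rw [hk]
      exact hg.isStrand
  · rw [← Order.succ_eq_add_one, Order.Iio_succ_eq_insert]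
    refine Set.PairwiseDisjoint.insert (fun l hl m hm hlm => ?_) fun l hl _ => ?_
    · change Disjoint (S' l).1 (S' m).1
      rw [hlt l hl, hlt m hm]
      exact hDD fun h => hlm (congrArg Subtype.val h)
    · rw [hk, hlt l hl]
      exact (hDg ⟨l, hl⟩).symm
  · rw [hlt l hl]
    exact ⟨rfl, hW ⟨l, hl⟩⟩

theorem exists_seq_isStage (h𝓕 : 𝓕 ≤ atTop) (hH : ∀ v, (H.neighborSet v).Finite)
    (hd : ∀ᶠ U in 𝓕, (boundary H U).ncard ≤ d) (hP : HasPackings (IsTypedDoubleRay G H 𝓕 R))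
    (hcount : H.support.Countable) :
    ∃ S : ℕ → ℕ → SimpleGraph V × V, (∀ k, IsStage G H 𝓕 R k (S k)) ∧
      (∀ l, ∀ k > l, (S (k + 1) l).2 = (S k l).2) ∧
      ∀ l w, ∀ᶠ k in atTop, (S (k + 1) l).1.neighborSet w = (S k l).1.neighborSet w := by
  classical
  obtain ⟨F, -⟩ := hP 1
  have : Nonempty V := ⟨F 0 0⟩
  obtain ⟨x, hx⟩ := Set.countable_iff_exists_subset_range.1 hcount
  obtain ⟨u, hu0, hu, hstep⟩ := exists_seq_of_forall_exists
    (P := fun p : ℕ × (ℕ → SimpleGraph V × V) => IsStage G H 𝓕 R p.1 p.2)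
    (R := fun p q => q.1 = p.1 + 1 ∧ ∀ l < p.1, (q.2 l).2 = (p.2 l).2 ∧
      ∀ w, w ∈ (Finset.range p.1).image x ∨ w ∉ H.support →
        (q.2 l).1.neighborSet w = (p.2 l).1.neighborSet w)
    (a := (0, fun _ => (⊥, F 0 0))) ⟨fun l hl => absurd hl l.not_lt_zero, by simp⟩ fun p hp => by
      obtain ⟨S', hS', h⟩ := hp.exists_succ h𝓕 hH hd hP ((Finset.range p.1).image x)
      exact ⟨(p.1 + 1, S'), hS', rfl, h⟩
  have hu1 : ∀ k, (u k).1 = k := fun k => by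
    induction k with
    | zero => rw [hu0]
    | succ k ih => rw [(hstep k).1, ih]
  simp only [hu1] at hu hstep
  refine ⟨fun k => (u k).2, hu, fun l k hk => ((hstep k).2 l hk).1, fun l w => ?_⟩
  by_cases hw : w ∈ H.support
  · obtain ⟨i, rfl⟩ := hx hw
    filter_upwards [eventually_gt_atTop l, eventually_gt_atTop i] with k hl hi
    exact ((hstep k).2 l hl).2 _ (.inl (Finset.mem_image_of_mem x (Finset.mem_range.2 hi)))
  · filter_upwards [eventually_gt_atTop l] with k hl
    exact ((hstep k).2 l hl).2 w (.inr hw)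

theorem HasInfinitePacking.of_hasPackings (h𝓕 : 𝓕 ≤ atTop) (hH : ∀ v, (H.neighborSet v).Finite)
    (hd : ∀ᶠ U in 𝓕, (boundary H U).ncard ≤ d) (hP : HasPackings (IsTypedDoubleRay G H 𝓕 R))
    (hcount : H.support.Countable) : HasInfinitePacking G := by
  obtain ⟨S, hS, hvS, hnbr⟩ := exists_seq_isStage h𝓕 hH hd hP hcount
  have hv : ∀ l, ∀ k > l, (S k l).2 = (S (l + 1) l).2 := fun l k hk => by
    induction k, hk using Nat.le_induction with
    | base => rfl
    | succ k hk ih => exact (hvS l k hk).trans ih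
  choose E hE using fun l => exists_locallyConverges (D := fun k => (S k l).1) (hnbr l)
  have hstrand : ∀ l, ∀ᶠ k in atTop, IsStrand G H 𝓕 R (S k l).1 (S (l + 1) l).2 := fun l => by
    filter_upwards [eventually_gt_atTop l] with k hk
    exact hv l k hk ▸ (hS k).isStrand l hk
  refine .of_pairwise_disjoint (D := E) (fun l => (hE l).le ((hstrand l).mono fun _ h => h.le))
    (fun l m hlm => (hE l).disjoint (hE m) ?_) fun l => ?_
  · filter_upwards [eventually_gt_atTop l, eventually_gt_atTop m] with k hl hm
    exact (hS k).disjoint hl hm hlm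
  · exact exists_isDoubleRay_of_isCycles ((hE l).isCycles ((hstrand l).mono fun _ h => h.isCycles))
      ((hE l).infinite_reachable ((hstrand l).mono fun _ h => h.infinite))

end Stages

/-! ### Small boundaries and finitely many types -/

/-- The possible states of the part of a graph outside a finite set, seen from `d` vertices: the
degrees, the pairs that are connected, and the vertices in infinite components. -/
abbrev BoundaryState (d : ℕ) : Type :=
  (Fin d → Fin 3) × (Fin d → Fin d → Prop) × (Fin d → Prop)

/-- The state of `D` outside `U`, seen from the vertices `c i`. Degrees are read modulo three, which
loses nothing as they are at most two in the graphs considered. -/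
noncomputable def boundaryState (H : SimpleGraph V) (U : Finset V) {d : ℕ} (c : Fin d → V)
    (D : SimpleGraph V) : BoundaryState d :=
  (fun i => Fin.ofNat 3 ((D ⊓ outside H U).neighborSet (c i)).ncard,
    fun i j => (D ⊓ outside H U).Reachable (c i) (c j),
    fun i => {w | (D ⊓ outside H U).Reachable (c i) w}.Infinite)

section BoundaryState

variable {D G H X : SimpleGraph V} {d : ℕ}

theorem ncard_neighborSet_inf_le_of_isCycles (hD : D.IsCycles) (v : V) :
    ((D ⊓ X).neighborSet v).ncard ≤ 2 :=
  (Set.ncard_le_ncard (fun _ h => h.1) (finite_neighborSet_of_isCycles hD v)).trans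
    (ncard_neighborSet_le_of_isCycles hD v)

theorem sameState_of_boundaryState_eq {U : Finset V} {c : Fin d → V}
    (hc : boundary H U ⊆ Set.range c) (hD : D.IsCycles) (hX : X.IsCycles)
    (h : boundaryState H U c D = boundaryState H U c X) : SameState H U D X := by
  obtain ⟨hdeg, hreach, hinf⟩ : _ ∧ _ ∧ _ := by
    simpa only [boundaryState, Prod.mk.injEq, funext_iff, eq_iff_iff] using h
  refine ⟨fun s hs => ?_, fun s hs t ht => ?_, fun s hs => ?_⟩ <;> obtain ⟨i, rfl⟩ := hc hs
  · have hmod := congrArg Fin.val (hdeg i)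
    have hDi := ncard_neighborSet_inf_le_of_isCycles (X := outside H U) hD (c i)
    have hXi := ncard_neighborSet_inf_le_of_isCycles (X := outside H U) hX (c i)
    simp only [Fin.val_ofNat] at hmod
    omega
  · obtain ⟨j, rfl⟩ := hc ht
    exact hreach i j
  · exact hinf i

theorem exists_subset_range_of_ncard_le [Nonempty V] {s : Set V} (hs : s.Finite)
    (h : s.ncard ≤ d) : ∃ c : Fin d → V, s ⊆ Set.range c := by
  have := hs.fintype
  obtain ⟨e⟩ : Nonempty (s ↪ Fin d) := Embedding.nonempty_of_card_le <| by
    rwa [Fintype.card_fin, ← Nat.card_eq_fintype_card]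
  exact ⟨extend e Subtype.val fun _ => Classical.arbitrary V,
    fun x hx => ⟨e ⟨x, hx⟩, e.injective.extend_apply _ _ _⟩⟩

theorem HasPackings.exists_eq {P : (ℤ → V) → Prop} (hP : HasPackings P) {σ : Type*} [Finite σ]
    (τ : (ℤ → V) → σ) : ∃ s, HasPackings fun f => P f ∧ τ f = s := by
  classical
  have := Fintype.ofFinite σ
  by_contra! hno
  simp only [HasPackings, not_forall] at hno
  choose k hk using hno
  obtain ⟨F, hF, hFF⟩ := hP (Fintype.card σ * ∑ s, k s + 1)
  obtain ⟨s, hs⟩ := Fintype.exists_lt_card_fiber_of_mul_lt_card (n := ∑ s, k s)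
    (fun i => τ (F i)) (by rw [Fintype.card_fin]; exact Nat.lt_succ_self _)
  have hks : k s ≤ ({i | τ (F i) = s} : Finset _).card :=
    (Finset.single_le_sum_of_canonicallyOrdered (f := k) (Finset.mem_univ s)).trans hs.le
  let e := Finset.orderEmbOfCardLe _ hks
  exact hk s ⟨fun i => F (e i),
    fun i => ⟨hF _, (Finset.mem_filter.1 (Finset.orderEmbOfCardLe_mem _ hks i)).2⟩,
    hFF.comp_of_injective e.injective⟩

theorem exists_eventually_eq {α σ : Type*} [Finite σ] (𝒰 : Ultrafilter α) (f : α → σ) :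
    ∃ s, ∀ᶠ a in 𝒰, f a = s := by
  obtain ⟨s, hs⟩ := (𝒰.map f).eq_pure_of_finite
  exact ⟨s, Ultrafilter.mem_map.1 (hs ▸ Ultrafilter.mem_pure.2 rfl : ({s} : Set σ) ∈ 𝒰.map f)⟩

theorem HasPackings.exists_isTypedDoubleRay (hH : ∀ v, (H.neighborSet v).Finite)
    {𝒰 : Ultrafilter (Finset V)} (hd : ∀ᶠ U in 𝒰, (boundary H U).ncard ≤ d)
    (hP : HasPackings fun f => IsDoubleRay G f ∧ AlmostLE (trace f) H) :
    ∃ R, HasPackings (IsTypedDoubleRay G H 𝒰 R) := by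
  obtain ⟨F, -⟩ := hP 1
  have : Nonempty V := ⟨F 0 0⟩
  have hcover : ∀ U : Finset V, ∃ c : Fin d → V, (boundary H U).ncard ≤ d →
      boundary H U ⊆ Set.range c := fun U => by
    by_cases hU : (boundary H U).ncard ≤ d
    · exact (exists_subset_range_of_ncard_le (finite_boundary hH U) hU).imp fun c hc _ => hc
    · exact ⟨fun _ => Classical.arbitrary V, fun h => (hU h).elim⟩
  choose c hc using hcover
  choose τ hτ using fun f : ℤ → V =>
    exists_eventually_eq 𝒰 fun U => boundaryState H U (c U) (trace f)
  obtain ⟨s, hs⟩ := hP.exists_eq τ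
  obtain ⟨r, hr, -⟩ := hs 1
  refine ⟨trace (r 0), fun k => (hs k).imp fun F hF => ⟨fun i => ?_, hF.2⟩⟩
  obtain ⟨⟨hf, hfH⟩, hfs⟩ := hF.1 i
  obtain ⟨⟨hr, -⟩, hrs⟩ := hr 0
  refine ⟨hf, hfH, ?_⟩
  filter_upwards [hd, hτ (F i), hτ (r 0)] with U hU hfU hrU
  refine sameState_of_boundaryState_eq (hc U hU) hf.isCycles_trace hr.isCycles_trace ?_
  rw [hfU, hrU, hfs, hrs]

theorem HasInfinitePacking.of_frequently_ncard_boundary_le (hH : ∀ v, (H.neighborSet v).Finite)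
    (hcount : H.support.Countable) (hd : ∃ᶠ U in atTop, (boundary H U).ncard ≤ d)
    (hP : HasPackings fun f => IsDoubleRay G f ∧ AlmostLE (trace f) H) :
    HasInfinitePacking G := by
  have : NeBot (atTop ⊓ 𝓟 {U : Finset V | (boundary H U).ncard ≤ d}) :=
    frequently_mem_iff_neBot.1 hd
  let 𝒰 := Ultrafilter.of (atTop ⊓ 𝓟 {U : Finset V | (boundary H U).ncard ≤ d})
  have h𝒰 : 𝒰 ≤ atTop ⊓ 𝓟 {U : Finset V | (boundary H U).ncard ≤ d} := Ultrafilter.of_le _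
  have hd𝒰 : ∀ᶠ U in 𝒰, (boundary H U).ncard ≤ d := le_principal_iff.1 (h𝒰.trans inf_le_right)
  obtain ⟨R, hR⟩ := hP.exists_isTypedDoubleRay hH hd𝒰
  exact .of_hasPackings (h𝒰.trans inf_le_left) hH hd𝒰 hR hcount

end BoundaryState

/-! ### A locally finite graph almost containing countably many double rays -/

theorem exists_locallyFinite_almostLE {ι : Type*} [Countable ι] [Nonempty V]
    {D : ι → SimpleGraph V} (hD : ∀ j v, ((D j).neighborSet v).Finite)
    (hcount : ∀ j, (D j).support.Countable) :
    ∃ H ≤ ⨆ j, D j, (∀ v, (H.neighborSet v).Finite) ∧ H.support.Countable ∧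
      ∀ j, AlmostLE (D j) H := by
  classical
  obtain ⟨e, he⟩ := exists_injective_nat ι
  have hsupp : (⨆ j, D j).support.Countable := (Set.countable_iUnion hcount).mono <| by
    rintro a ⟨b, hab⟩
    exact (iSup_adj.1 hab).elim fun j hj => Set.mem_iUnion.2 ⟨j, b, hj⟩
  obtain ⟨x, hx⟩ := Set.countable_iff_exists_subset_range.1 hsupp
  have hle : ⨆ j, outside (D j) ((Finset.range (e j)).image x) ≤ ⨆ j, D j :=
    iSup_mono fun j a b hab => hab.1
  refine ⟨_, hle, fun v => ?_, hsupp.mono (support_mono hle), fun j => ?_⟩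
  · by_cases hv : v ∈ Set.range x
    · obtain ⟨i, rfl⟩ := hv
      refine (((Set.finite_Iic i).preimage he.injOn).biUnion fun j _ => hD j (x i)).subset ?_
      intro b hb
      obtain ⟨j, hj, hji, -⟩ := iSup_adj.1 hb
      have hji' : e j ≤ i := not_lt.1 fun hij =>
        hji (Finset.mem_image_of_mem x (Finset.mem_range.2 hij))
      exact Set.mem_biUnion hji' hj
    · exact Set.finite_empty.subset fun b hb => hv (hx ⟨b, hle hb⟩)
  · exact (almostLE_outside (almostLE_of_le le_rfl) (hD j) _).trans
      (almostLE_of_le (le_iSup (fun j => outside (D j) ((Finset.range (e j)).image x)) j))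

theorem HasPackings.hasInfinitePacking {G : SimpleGraph V} (hP : HasPackings (IsDoubleRay G)) :
    HasInfinitePacking G := by
  choose F hF using hP
  have : Nonempty V := ⟨F 1 0 0⟩
  let X : (Σ k, Fin k) → ℤ → V := fun p => F p.1 p.2
  have hX : ∀ p, IsDoubleRay G (X p) := fun p => (hF p.1).1 p.2
  obtain ⟨H, hHX, hH, hcount, hXH⟩ := exists_locallyFinite_almostLE
    (fun p => finite_neighborSet_of_isCycles (hX p).isCycles_trace)
    (fun p => (Set.countable_range (X p)).mono (support_trace_subset (f := X p)))
  by_cases hd : ∃ d, ∃ᶠ U in atTop, (boundary H U).ncard ≤ d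
  · obtain ⟨d, hd⟩ := hd
    exact .of_frequently_ncard_boundary_le hH hcount hd fun k =>
      ⟨F k, fun i => ⟨hX ⟨k, i⟩, hXH ⟨k, i⟩⟩, (hF k).2⟩
  · simp only [not_exists, not_frequently, not_le, eventually_atTop] at hd
    obtain ⟨r, hr, hrr⟩ := exists_disjoint_rays_of_lt_ncard_boundary hH hd
    refine .of_disjoint_rays
      (fun i => (hr i).mono (hHX.trans (iSup_le fun p => (hX p).trace_le))) hrr fun i => ?_
    obtain ⟨p, hp⟩ := iSup_adj.1 (hHX ((hr i).adj 0))
    exact ⟨X p, hX p, mem_range_of_edgesOn_adj hp⟩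

end EdgeDisjointDoubleRays

open EdgeDisjointDoubleRays

theorem theorem1 {V : Type*} (G : SimpleGraph V)
    (hG : G.HasArbitrarilyManyEdgeDisjoint doubleRay) :
    G.HasInfinitelyManyEdgeDisjoint doubleRay := by
  have hP : HasPackings (IsDoubleRay G) := fun k => exists_isEdgeDisjointFamilyIn_iff.1 (hG k)
  exact exists_isEdgeDisjointFamilyIn_iff.2 hP.hasInfinitePacking
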